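/- Let $0<k\le l$ and $L_0,M_c,M>0$. For $(x,v)\in\mathbb R^3\times\mathbb R^3$ put $L=|x\times v|^2=|x|^2|v|^2-(x\cdot v)^2$. For $f\in L^1(\mathbb R^6)$ put $\rho_f(x)=\int f(x,v)\,dv$ and $m_f(r)=\int_{|x|\le r}\rho_f\,dx$, and for spherically symmetric $f$ let $$\nabla U_f(x)=\frac{m_f(|x|)}{|x|^2}\frac{x}{|x|},\qquad U_f(x)=-\int_{|x|}^\infty \frac{m_f(s)}{s^2}\,ds .$$ Define $$E_{\rm kin}(f)=\tfrac12\iint |v|^2 f\,dv\,dx,\qquad E_{\rm pot}(f)=-\frac1{8\pi}\int|\nabla U_f|^2dx-\int\frac{M_c}{|x|}\rho_f\,dx,$$ $$\mathcal C(f)=\iint f^{1+1/k}(L-L_0)_+^{-l/k}\,dv\,dx,\qquad \mathcal H_C=E_{\rm kin}+E_{\rm pot}+\mathcal C,$$ and let $\mathcal F_M$ be the set of all $f\in L^1(\mathbb R^6)$ such that $f\ge 0$, $f$ is spherically symmetric ($f(Ax,Av)=f(x,v)$ for all $A\in O(3)$), $\iint f=M$, $E_{\rm kin}(f)+\mathcal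 C(f)<\infty$, and $f=0$ a.e. on $\{L<L_0\}$. Theorem. Let $f_0\in\mathcal F_M$ be a minimizer of $\mathcal H_C$ over $\mathcal F_M$, and let $U_0=U_{f_0}$. Then there exists $E_0<0$ such that, almost everywhere, $$f_0(x,v)=\Big(\frac{k}{k+1}\Big)^{k}(E_0-E)_+^k\,(L-L_0)_+^l,\qquad E=\tfrac12|v|^2+U_0(x)-\frac{M_c}{|x|}.$$ Moreover $U_0\in C^2(\mathbb R^3)$, and, with $f_0$ denoting the representative given by this formula, $(f_0,U_0)$ is a steady state of the Vlasov–Poisson system with the point mass $M_c$ fixed at the origin: * $f_0\ge0$ solves the Vlasov equation, i.e. it is constant along all solutions, with $X\neq0$, of $\dot X=V$, $\dot V=-\nabla\big(U_0-\tfrac{M_c}{|\cdot|}\big)(X)$; and $v\cdot\nabla_xf_0-\nabla_x\big(U_0-\tfrac{M_c}{|x|}\big)\cdot\nabla_vf_0=0$ at every point $(x,v)$, $x\ne0$, at which $f_0$ is differentiable; * for every $x\in\mathbb R^3$ the function $f_0(x,\cdot)$ is integrable and $\Delta U_0(x)=4\pi\rho_{f_0}(x)$ with $\rho_{f_0}(x)=\int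 f_0(x,v)\,dv$; and $\lim_{|x|\to\infty}U_0(x)=0$. It is a static shell: there are $0<R_1<R_2<\infty$ such that $\rho_{f_0}(x)=0$ unless $R_1\le|x|\le R_2$. -/

import Mathlib

open MeasureTheory Set Filter Topology

namespace VPShell

/-- Position space and velocity space `ℝ³`, with the Euclidean norm. -/
abbrev Space : Type := EuclideanSpace ℝ (Fin 3)

/-- Phase space `ℝ³ × ℝ³`; a point is `z = (x, v)`. -/
abbrev Phase : Type := Space × Space

/-- The squared modulus of angular momentum,
`L = |x × v|² = |x|² |v|² - (x · v)²`. -/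
noncomputable def angMomSq (z : Phase) : ℝ :=
  ‖z.1‖ ^ 2 * ‖z.2‖ ^ 2 - (inner ℝ z.1 z.2) ^ 2

/-- The spatial density `ρ_f (x) = ∫ f (x, v) dv`. -/
noncomputable def density (f : Phase → ℝ) (x : Space) : ℝ :=
  ∫ v : Space, f (x, v)

/-- The mass inside the ball of radius `r`: `m_f (r) = ∫_{|x| ≤ r} ρ_f (x) dx`. -/
noncomputable def ballMass (f : Phase → ℝ) (r : ℝ) : ℝ :=
  ∫ x in Metric.closedBall (0 : Space) r, density f x

/-- The gravitational field `∇U_f (x) = (m_f (r) / r²) (x / r)`, `r = |x|`, induced by a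
spherically symmetric `f`. -/
noncomputable def field (f : Phase → ℝ) (x : Space) : Space :=
  (ballMass f ‖x‖ / ‖x‖ ^ 2) • (‖x‖⁻¹ • x)

/-- The potential `U_f (x) = - ∫_{|x|}^∞ m_f (s) / s² ds` induced by a spherically
symmetric `f`. -/
noncomputable def potential (f : Phase → ℝ) (x : Space) : ℝ :=
  - ∫ s in Ioi ‖x‖, ballMass f s / s ^ 2

/-- The kinetic energy `½ ∫∫ |v|² f dv dx` of a nonnegative `f`, with values in `[0, ∞]`. -/
noncomputable def kineticEnergy (f : Phase → ℝ) : ENNReal :=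
  ∫⁻ z : Phase, ENNReal.ofReal ((1 / 2) * ‖z.2‖ ^ 2 * f z)

/-- The Casimir functional `∫∫ f^{1+1/k} (L - L₀)₊^{-l/k} dv dx` of a nonnegative `f`, with
values in `[0, ∞]`. Here `0^{-l/k} = ∞` and `0 · ∞ = 0`, so that the integrand is `∞`
exactly where `f > 0` and `L ≤ L₀`. -/
noncomputable def casimir (k l L0 : ℝ) (f : Phase → ℝ) : ENNReal :=
  ∫⁻ z : Phase, ENNReal.ofReal (f z) ^ (1 + 1 / k) *
    ENNReal.ofReal (angMomSq z - L0) ^ (-(l / k))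

/-- The potential energy, with the interaction term of the point mass:
`- (1 / 8π) ∫ (|∇U_f|² + (8π M_c / |x|) ρ_f) dx`. -/
noncomputable def potentialEnergy (Mc : ℝ) (f : Phase → ℝ) : ℝ :=
  - (1 / (8 * Real.pi)) * (∫ x : Space, ‖field f x‖ ^ 2)
    - ∫ x : Space, Mc / ‖x‖ * density f x

/-- The energy-Casimir functional (used on functions for which the kinetic energy and the
Casimir functional are finite). -/
noncomputable def energyCasimir (k l L0 Mc : ℝ) (f : Phase → ℝ) : ℝ :=
  (kineticEnergy f).toReal + potentialEnergy Mc f + (casimir k l L0 f).toReal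

/-- Spherical symmetry of (the almost-everywhere class of) `f`: it has a representative `g`
with `g (A x, A v) = g (x, v)` for every orthogonal `A`. -/
def SphericallySymmetric (f : Phase → ℝ) : Prop :=
  ∃ g : Phase → ℝ, Measurable g ∧ f =ᵐ[volume] g ∧
    ∀ (A : Space ≃ₗᵢ[ℝ] Space) (x v : Space), g (A x, A v) = g (x, v)

/-- The constraint set `𝓕_M`, whose elements are given by representatives of `L¹` classes. -/
def admissible (k l L0 M : ℝ) : Set (Phase → ℝ) :=
  {f | Integrable f ∧ (∀ᵐ z, 0 ≤ f z) ∧ SphericallySymmetric f ∧ ∫ z, f z = M ∧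
    kineticEnergy f + casimir k l L0 f < ⊤ ∧ ∀ᵐ z, angMomSq z < L0 → f z = 0}

/-- The effective potential `U (x) - M_c / |x|`. -/
noncomputable def effPotential (Mc : ℝ) (U : Space → ℝ) (x : Space) : ℝ :=
  U x - Mc / ‖x‖

/-- The particle energy `E = ½ |v|² + U (x) - M_c / |x|`. -/
noncomputable def particleEnergy (Mc : ℝ) (U : Space → ℝ) (z : Phase) : ℝ :=
  (1 / 2) * ‖z.2‖ ^ 2 + U z.1 - Mc / ‖z.1‖

/-- `(k / (k+1))^k (E₀ - E)₊^k (L - L₀)₊^l`. -/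
noncomputable def shell (k l L0 Mc E0 : ℝ) (U : Space → ℝ) (z : Phase) : ℝ :=
  (k / (k + 1)) ^ k * (max (E0 - particleEnergy Mc U z) 0) ^ k *
    (max (angMomSq z - L0) 0) ^ l

/-- `(X, V)` solves the characteristic system `X' = V`, `V' = - ∇ (U - M_c / |·|) (X)` on the
time interval `(a, b)`, away from the point mass. -/
def IsCharacteristic (Mc : ℝ) (U : Space → ℝ) (a b : ℝ) (X V : ℝ → Space) : Prop :=
  ∀ s ∈ Ioo a b, X s ≠ 0 ∧ HasDerivAt X (V s) s ∧
    HasDerivAt V (- gradient (effPotential Mc U) (X s)) s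

/-- `(f, U)` is a time-independent solution of the Vlasov-Poisson system with a point mass
`Mc` fixed at the origin. -/
structure IsSteadyState (Mc : ℝ) (f : Phase → ℝ) (U : Space → ℝ) : Prop where
  nonneg : ∀ z, 0 ≤ f z
  /-- The Vlasov equation: `f` is constant along characteristics. -/
  const_along : ∀ (a b : ℝ) (X V : ℝ → Space), IsCharacteristic Mc U a b X V →
    ∀ s ∈ Ioo a b, ∀ t ∈ Ioo a b, f (X s, V s) = f (X t, V t)
  /-- The Vlasov equation `v · ∇ₓ f - ∇ₓ (U - M_c / |x|) · ∇ᵥ f = 0` holds pointwise wherever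
  `f` is differentiable. -/
  vlasov : ∀ x v : Space, x ≠ 0 → DifferentiableAt ℝ f (x, v) →
    inner ℝ v (gradient (fun y : Space => f (y, v)) x)
      - inner ℝ (gradient (effPotential Mc U) x) (gradient (fun w : Space => f (x, w)) v) = 0
  potential_contDiff : ContDiff ℝ 2 U
  /-- The density `∫ f (x, v) dv` exists at every point. -/
  integrable_velocity : ∀ x : Space, Integrable (fun v : Space => f (x, v))
  /-- The Poisson equation `Δ U = 4π ρ_f`. -/
  poisson : ∀ x : Space, Laplacian.laplacian U x = 4 * Real.pi * density f x
  tendsto_potential : Tendsto U (cocompact Space) (𝓝 0)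

/-- The spatial density of `f` is supported in a spherical shell `R₁ ≤ |x| ≤ R₂`, `R₁ > 0`. -/
def IsShell (f : Phase → ℝ) : Prop :=
  ∃ R1 R2 : ℝ, 0 < R1 ∧ R1 < R2 ∧ ∀ x : Space, density f x ≠ 0 → R1 ≤ ‖x‖ ∧ ‖x‖ ≤ R2

end VPShell

namespace VPShell

/-! No Euler–Lagrange variation is carried out. Freeze the potential `U₀` of the minimizer `f₀` and
compare `f₀` with the shell `g` built from `U₀` whose cut-off energy `E₀ < 0` is tuned to give mass
`M` (`RadialWell.exists_mass_eq`). The potential energy is concave, so it lies below its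
linearization at `f₀` (`FiniteEnergy.potentialEnergy_le`). Minimality of `f₀` then says that the
linearized functional, with `E₀` as multiplier for the mass, is no larger at `f₀` than at `g`. But
its integrand is strictly minimized at each point with `L > L₀` by the value of `g`
(`shell_strict_min`), while finiteness of the Casimir functional forces `f₀ = 0 = g` where `L ≤ L₀`.
Hence `f₀ = g` almost everywhere (`minimizer_ae_eq_shell`).

The tuning of `E₀` is an intermediate value argument. The mass of the shell is continuous in `E₀ <
0` and zero for very negative `E₀`. It is unbounded as `E₀ → 0`, because the point mass alone binds
a region of infinite phase space volume on which, thanks to `k ≤ l`, the limiting shell stays above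
a positive constant.

The angular momentum barrier `L > L₀` keeps the shell away from the origin and `E₀ < 0` keeps it
bounded. The density is therefore continuous and vanishes near `0`, which makes `U₀` a `C²` radial
solution of Poisson's equation. The Vlasov equation holds because `E` and `L` are conserved in a
central field. -/

theorem angMomSq_le (z : Phase) : angMomSq z ≤ ‖z.1‖ ^ 2 * ‖z.2‖ ^ 2 := by
  unfold angMomSq
  nlinarith [sq_nonneg (inner ℝ z.1 z.2 : ℝ)]

theorem continuous_angMomSq : Continuous angMomSq := by
  unfold angMomSq
  fun_prop

/-! ### Finite-energy densities, their ball masses and potentials -/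

/-- Nonnegative integrable phase space densities of finite kinetic energy that vanish where the
angular momentum is small. -/
structure FiniteEnergy (L0 : ℝ) (f : Phase → ℝ) : Prop where
  integrable : Integrable f
  nonneg : ∀ᵐ z, 0 ≤ f z
  support : ∀ᵐ z, f z ≠ 0 → L0 ≤ angMomSq z
  kinetic : Integrable fun z : Phase => (1 / 2) * ‖z.2‖ ^ 2 * f z

theorem admissible.kineticEnergy_lt_top {k l L0 M : ℝ} {f : Phase → ℝ}
    (hf : f ∈ admissible k l L0 M) : kineticEnergy f < ⊤ :=
  lt_of_le_of_lt le_self_add hf.2.2.2.2.1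

theorem admissible.casimir_lt_top {k l L0 M : ℝ} {f : Phase → ℝ}
    (hf : f ∈ admissible k l L0 M) : casimir k l L0 f < ⊤ :=
  lt_of_le_of_lt le_add_self hf.2.2.2.2.1

theorem admissible.finiteEnergy {k l L0 M : ℝ} {f : Phase → ℝ}
    (hf : f ∈ admissible k l L0 M) : FiniteEnergy L0 f where
  integrable := hf.1
  nonneg := hf.2.1
  support := by
    filter_upwards [hf.2.2.2.2.2] with z hz h
    by_contra hc
    exact h (hz (not_le.1 hc))
  kinetic := by
    have hm : AEStronglyMeasurable (fun z : Phase => (1 / 2) * ‖z.2‖ ^ 2 * f z) :=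
      (by fun_prop : Continuous fun z : Phase => (1 / 2) * ‖z.2‖ ^ 2).aestronglyMeasurable.mul
        hf.1.aestronglyMeasurable
    refine ⟨hm, ?_⟩
    rw [hasFiniteIntegral_iff_ofReal]
    · exact admissible.kineticEnergy_lt_top hf
    · filter_upwards [hf.2.1] with z hz
      positivity

namespace FiniteEnergy

variable {L0 : ℝ} {f h : Phase → ℝ}

theorem kineticEnergy_toReal (hf : FiniteEnergy L0 f) :
    (kineticEnergy f).toReal = ∫ z : Phase, (1 / 2) * ‖z.2‖ ^ 2 * f z := by
  rw [integral_eq_lintegral_of_nonneg_ae _ hf.kinetic.aestronglyMeasurable]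
  · rfl
  · filter_upwards [hf.nonneg] with z hz
    positivity

theorem support_ne_zero (hL0 : 0 < L0) (hf : FiniteEnergy L0 f) : ∀ᵐ z, f z ≠ 0 → z.1 ≠ 0 := by
  filter_upwards [hf.support] with z hz h hx
  have h1 := hz h
  have h2 := angMomSq_le z
  rw [hx] at h2
  simp at h2
  linarith

/-- On the support `L₀ ≤ |x|²|v|²`, so `|x|⁻² ≤ |v|²/L₀`, and `|x|⁻¹ ≤ (1 + |x|⁻²)/2`. Mass and
kinetic energy thus control the interaction with the point mass. -/
theorem integrable_inv_norm_mul (hL0 : 0 < L0) (hf : FiniteEnergy L0 f) :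
    Integrable fun z : Phase => ‖z.1‖⁻¹ * f z := by
  have hb : Integrable fun z : Phase =>
      (1 / 2) * f z + L0⁻¹ * ((1 / 2) * ‖z.2‖ ^ 2 * f z) :=
    (hf.integrable.const_mul _).add (hf.kinetic.const_mul _)
  refine hb.mono' ?_ ?_
  · exact (by fun_prop : Measurable fun z : Phase => ‖z.1‖⁻¹).aestronglyMeasurable.mul
      hf.integrable.aestronglyMeasurable
  · filter_upwards [hf.support, hf.nonneg, hf.support_ne_zero hL0] with z hz h0 hx
    by_cases hfz : f z = 0
    · simp [hfz]
    have hr : 0 < ‖z.1‖ := norm_pos_iff.2 (hx hfz)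
    have hL := (hz hfz).trans (angMomSq_le z)
    have key : ‖z.1‖⁻¹ ≤ 1 / 2 + L0⁻¹ * ((1 / 2) * ‖z.2‖ ^ 2) := by
      have h1 : (‖z.1‖⁻¹) ^ 2 ≤ L0⁻¹ * ‖z.2‖ ^ 2 := by
        rw [inv_pow, inv_mul_eq_div, inv_le_iff_one_le_mul₀ (by positivity), div_mul_eq_mul_div,
          le_div_iff₀ hL0]
        linarith
      nlinarith [sq_nonneg (‖z.1‖⁻¹ - 1)]
    rw [Real.norm_of_nonneg (by positivity)]
    calc ‖z.1‖⁻¹ * f z ≤ (1 / 2 + L0⁻¹ * ((1 / 2) * ‖z.2‖ ^ 2)) * f z := by gcongr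
      _ = _ := by ring

theorem ballMass_eq (hf : FiniteEnergy L0 f) (r : ℝ) :
    ballMass f r = ∫ z : Phase, {z : Phase | ‖z.1‖ ≤ r}.indicator f z := by
  have hs : {z : Phase | ‖z.1‖ ≤ r} = Metric.closedBall (0 : Space) r ×ˢ (univ : Set Space) := by
    ext z
    simp
  have hm : MeasurableSet {z : Phase | ‖z.1‖ ≤ r} := by
    rw [hs]
    exact Metric.isClosed_closedBall.measurableSet.prod MeasurableSet.univ
  rw [integral_indicator hm, hs, Measure.volume_eq_prod, setIntegral_prod]
  · simp [ballMass, density]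
  · exact hf.integrable.integrableOn

theorem measurableSet_norm_le (r : ℝ) : MeasurableSet {z : Phase | ‖z.1‖ ≤ r} :=
  (isClosed_le (by fun_prop) continuous_const).measurableSet

theorem ballMass_mono (hf : FiniteEnergy L0 f) : Monotone (ballMass f) := by
  intro r s hrs
  rw [hf.ballMass_eq, hf.ballMass_eq]
  refine integral_mono_ae (hf.integrable.indicator (measurableSet_norm_le r))
    (hf.integrable.indicator (measurableSet_norm_le s)) ?_
  filter_upwards [hf.nonneg] with z hz
  simp only [indicator, mem_ofPred_eq]
  split_ifs with h1 h2
  · exact le_rfl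
  · exact absurd (h1.trans hrs) h2
  · exact hz
  · exact le_rfl

theorem ballMass_nonneg (hf : FiniteEnergy L0 f) (r : ℝ) : 0 ≤ ballMass f r := by
  rw [hf.ballMass_eq]
  refine integral_nonneg_of_ae ?_
  filter_upwards [hf.nonneg] with z hz
  exact indicator_apply_nonneg fun _ => hz

theorem ballMass_le_integral (hf : FiniteEnergy L0 f) (r : ℝ) : ballMass f r ≤ ∫ z, f z := by
  rw [hf.ballMass_eq]
  refine integral_mono_ae (hf.integrable.indicator (measurableSet_norm_le r)) hf.integrable ?_
  filter_upwards [hf.nonneg] with z hz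
  exact indicator_apply_le' (fun _ => le_rfl) fun _ => hz

/-- Markov's inequality for the weight `|x|⁻¹`. Linear growth at `0` is what cancels the `s⁻²` in
the field energy. -/
theorem ballMass_le_mul (hL0 : 0 < L0) (hf : FiniteEnergy L0 f) {r : ℝ} (hr : 0 ≤ r) :
    ballMass f r ≤ r * ∫ z : Phase, ‖z.1‖⁻¹ * f z := by
  rw [hf.ballMass_eq, ← integral_const_mul]
  refine integral_mono_ae (hf.integrable.indicator (measurableSet_norm_le r))
    ((hf.integrable_inv_norm_mul hL0).const_mul r) ?_
  filter_upwards [hf.nonneg, hf.support_ne_zero hL0] with z hz hx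
  refine indicator_apply_le' (fun hzr => ?_) fun _ => by positivity
  by_cases hfz : f z = 0
  · simp [hfz]
  have hpos : 0 < ‖z.1‖ := norm_pos_iff.2 (hx hfz)
  have : 1 ≤ r * ‖z.1‖⁻¹ := by
    rw [← div_eq_mul_inv, one_le_div hpos]
    exact hzr
  nlinarith

theorem measurable_ballMass (hf : FiniteEnergy L0 f) : Measurable (ballMass f) :=
  hf.ballMass_mono.measurable

theorem integrableOn_ballMass_mul (hL0 : 0 < L0) (hf : FiniteEnergy L0 f)
    (hh : FiniteEnergy L0 h) :
    IntegrableOn (fun s => ballMass h s * ballMass f s / s ^ 2) (Ioi 0) := by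
  have hmeas : Measurable fun s => ballMass h s * ballMass f s / s ^ 2 :=
    (hh.measurable_ballMass.mul hf.measurable_ballMass).div (by fun_prop)
  have hnn : ∀ s, 0 ≤ ballMass h s * ballMass f s / s ^ 2 := fun s =>
    div_nonneg (mul_nonneg (hh.ballMass_nonneg s) (hf.ballMass_nonneg s)) (sq_nonneg s)
  rw [← Ioc_union_Ioi_eq_Ioi (zero_le_one' ℝ)]
  refine IntegrableOn.union ?_ ?_
  · refine Measure.integrableOn_of_bounded
      (M := (∫ z : Phase, ‖z.1‖⁻¹ * h z) * ∫ z : Phase, ‖z.1‖⁻¹ * f z)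
      (by simp) hmeas.aestronglyMeasurable ?_
    filter_upwards [ae_restrict_mem measurableSet_Ioc] with s hs
    rw [Real.norm_of_nonneg (hnn s), div_le_iff₀ (by have := hs.1; positivity)]
    calc ballMass h s * ballMass f s
        ≤ (s * ∫ z : Phase, ‖z.1‖⁻¹ * h z) * (s * ∫ z : Phase, ‖z.1‖⁻¹ * f z) :=
          mul_le_mul (hh.ballMass_le_mul hL0 hs.1.le) (hf.ballMass_le_mul hL0 hs.1.le)
            (hf.ballMass_nonneg s)
            ((hh.ballMass_nonneg s).trans (hh.ballMass_le_mul hL0 hs.1.le))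
      _ = _ := by ring
  · have hi : IntegrableOn (fun s : ℝ => ((∫ z, h z) * ∫ z, f z) * s ^ (-2 : ℝ)) (Ioi 1) :=
      (integrableOn_Ioi_rpow_of_lt (by norm_num) one_pos).const_mul _
    refine hi.mono' hmeas.aestronglyMeasurable ?_
    filter_upwards [ae_restrict_mem measurableSet_Ioi] with s hs
    have hs0 : (0 : ℝ) < s := one_pos.trans hs
    rw [Real.norm_of_nonneg (hnn s), Real.rpow_neg hs0.le, Real.rpow_two, ← div_eq_mul_inv]
    exact div_le_div_of_nonneg_right (mul_le_mul (hh.ballMass_le_integral s)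
      (hf.ballMass_le_integral s) (hf.ballMass_nonneg s) (integral_nonneg_of_ae hh.nonneg))
      (sq_nonneg s)

theorem integrableOn_ballMass_div_sq (hf : FiniteEnergy L0 f) {r : ℝ} (hr : 0 < r) :
    IntegrableOn (fun s => ballMass f s / s ^ 2) (Ioi r) := by
  have hi : IntegrableOn (fun s : ℝ => (∫ z, f z) * s ^ (-2 : ℝ)) (Ioi r) :=
    (integrableOn_Ioi_rpow_of_lt (by norm_num) hr).const_mul _
  refine hi.mono' (hf.measurable_ballMass.div (by fun_prop)).aestronglyMeasurable ?_
  filter_upwards [ae_restrict_mem measurableSet_Ioi] with s hs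
  have hs0 : (0 : ℝ) < s := hr.trans hs
  rw [Real.norm_of_nonneg (div_nonneg (hf.ballMass_nonneg s) (sq_nonneg s)), Real.rpow_neg hs0.le,
    Real.rpow_two, ← div_eq_mul_inv]
  gcongr
  exact hf.ballMass_le_integral s

theorem potential_nonpos (hf : FiniteEnergy L0 f) (x : Space) : potential f x ≤ 0 := by
  unfold potential
  rw [neg_nonpos]
  exact integral_nonneg fun s => div_nonneg (hf.ballMass_nonneg s) (sq_nonneg s)

theorem neg_div_le_potential (hf : FiniteEnergy L0 f) {x : Space} (hx : x ≠ 0) :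
    -((∫ z, f z) / ‖x‖) ≤ potential f x := by
  have hr : 0 < ‖x‖ := norm_pos_iff.2 hx
  unfold potential
  rw [neg_le_neg_iff]
  calc ∫ s in Ioi ‖x‖, ballMass f s / s ^ 2
      ≤ ∫ s in Ioi ‖x‖, (∫ z, f z) * s ^ (-2 : ℝ) := by
        refine setIntegral_mono_on (hf.integrableOn_ballMass_div_sq hr)
          ((integrableOn_Ioi_rpow_of_lt (by norm_num) hr).const_mul _) measurableSet_Ioi ?_
        intro s hs
        rw [Real.rpow_neg (hr.trans hs).le, Real.rpow_two, ← div_eq_mul_inv]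
        gcongr
        exact hf.ballMass_le_integral s
    _ = (∫ z, f z) / ‖x‖ := by
        rw [integral_const_mul, integral_Ioi_rpow_of_lt (by norm_num) hr]
        norm_num [Real.rpow_neg_one, div_eq_mul_inv]

theorem potential_eq (x : Space) (hx : x ≠ 0) :
    potential h x = -∫ s in Ioi 0, {s | ‖x‖ ≤ s}.indicator (fun s => ballMass h s / s ^ 2) s := by
  have hr : 0 < ‖x‖ := norm_pos_iff.2 hx
  have : {s | ‖x‖ ≤ s} = Ici ‖x‖ := rfl
  have hsub : Ioi 0 ∩ Ici ‖x‖ = Ici ‖x‖ :=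
    inter_eq_self_of_subset_right fun s hs => lt_of_lt_of_le hr hs
  rw [this, setIntegral_indicator measurableSet_Ici, hsub, integral_Ici_eq_integral_Ioi]
  rfl

theorem measurable_potential (hf : FiniteEnergy L0 f) : Measurable (potential f) := by
  unfold potential
  refine Measurable.neg ?_
  have : (fun x : Space => ∫ s in Ioi ‖x‖, ballMass f s / s ^ 2) =
      fun x => ∫ s, {p : Space × ℝ | ‖p.1‖ < p.2}.indicator
        (fun p => ballMass f p.2 / p.2 ^ 2) (x, s) := by
    ext x
    rw [← integral_indicator measurableSet_Ioi]
    rfl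
  rw [this]
  refine (StronglyMeasurable.integral_prod_right (f := fun (x : Space) (s : ℝ) =>
    {p : Space × ℝ | ‖p.1‖ < p.2}.indicator (fun p => ballMass f p.2 / p.2 ^ 2) (x, s))
    ?_).measurable
  refine Measurable.stronglyMeasurable ?_
  refine Measurable.indicator ?_ (isOpen_lt (by fun_prop) (by fun_prop)).measurableSet
  exact (hf.measurable_ballMass.comp measurable_snd).div (by fun_prop)

/-- Fubini for `(m_h(s)/s²) 1_{|x| ≤ s} f(z)`: integrating in `s` first gives `-U_h f`, integrating
in `z` first gives `m_h m_f / s²`. This exhibits the interaction energy as a symmetric bilinear form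
without integration by parts. -/
theorem potential_mul_aux (hL0 : 0 < L0) (hf : FiniteEnergy L0 f) (hh : FiniteEnergy L0 h) :
    Integrable (fun z : Phase => potential h z.1 * f z) ∧
    ∫ z : Phase, potential h z.1 * f z = -∫ s in Ioi 0, ballMass h s * ballMass f s / s ^ 2 := by
  set F : Phase × ℝ → ℝ := fun p =>
    {p : Phase × ℝ | ‖p.1.1‖ ≤ p.2}.indicator (fun p => ballMass h p.2 / p.2 ^ 2 * f p.1) p with hF
  have hFx : ∀ z s, F (z, s) = ballMass h s / s ^ 2 *
      {z : Phase | ‖z.1‖ ≤ s}.indicator f z := by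
    intro z s
    simp only [hF, indicator, mem_ofPred_eq]
    split_ifs <;> simp
  have hFs : ∀ z s, F (z, s) =
      {s | ‖z.1‖ ≤ s}.indicator (fun s => ballMass h s / s ^ 2) s * f z := by
    intro z s
    simp only [hF, indicator, mem_ofPred_eq]
    split_ifs <;> simp
  have hmeas : AEStronglyMeasurable F (volume.prod (volume.restrict (Ioi 0))) := by
    refine AEStronglyMeasurable.indicator ?_
      (isClosed_le (by fun_prop) (by fun_prop)).measurableSet
    refine AEStronglyMeasurable.mul ?_ hf.integrable.aestronglyMeasurable.comp_fst
    exact ((hh.measurable_ballMass.comp measurable_snd).div (by fun_prop)).aestronglyMeasurable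
  have hnn : ∀ s, 0 ≤ ballMass h s / s ^ 2 := fun s =>
    div_nonneg (hh.ballMass_nonneg s) (sq_nonneg s)
  have hint : Integrable F (volume.prod (volume.restrict (Ioi 0))) := by
    rw [integrable_prod_iff' hmeas]
    refine ⟨ae_of_all _ fun s => ?_, ?_⟩
    · simp only [hFx]
      exact (hf.integrable.indicator (measurableSet_norm_le s)).const_mul _
    · refine (integrableOn_ballMass_mul hL0 hf hh).congr_fun (fun s _ => ?_) measurableSet_Ioi
      simp only [hFx]
      rw [mul_div_right_comm, hf.ballMass_eq, ← integral_const_mul]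
      refine integral_congr_ae ?_
      filter_upwards [hf.nonneg] with z hz
      rw [Real.norm_of_nonneg]
      exact mul_nonneg (hnn s) (indicator_apply_nonneg fun _ => hz)
  have hae : ∀ᵐ z : Phase, ∫ s in Ioi 0, F (z, s) = -(potential h z.1 * f z) := by
    filter_upwards [hf.support_ne_zero hL0] with z hz
    simp only [hFs]
    rw [integral_mul_const]
    by_cases hfz : f z = 0
    · simp [hfz]
    · rw [potential_eq _ (hz hfz)]
      ring
  constructor
  · have h1 := hint.integral_prod_left
    simpa using (h1.congr hae).neg
  · have h1 := integral_integral_swap (f := fun z s => F (z, s)) hint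
    rw [integral_congr_ae hae, integral_neg] at h1
    rw [← neg_eq_iff_eq_neg, h1]
    refine setIntegral_congr_fun measurableSet_Ioi fun s _ => ?_
    simp only [hFx]
    rw [mul_div_right_comm, hf.ballMass_eq s, ← integral_const_mul]

theorem integrable_potential_mul (hL0 : 0 < L0) (hf : FiniteEnergy L0 f)
    (hh : FiniteEnergy L0 h) : Integrable fun z : Phase => potential h z.1 * f z :=
  (potential_mul_aux hL0 hf hh).1

theorem integral_potential_mul (hL0 : 0 < L0) (hf : FiniteEnergy L0 f) (hh : FiniteEnergy L0 h) :
    ∫ z : Phase, potential h z.1 * f z = -∫ s in Ioi 0, ballMass h s * ballMass f s / s ^ 2 :=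
  (potential_mul_aux hL0 hf hh).2

end FiniteEnergy

/-! ### Radial form and concavity of the potential energy -/

theorem finrank_space : Module.finrank ℝ Space = 3 := by simp

theorem volume_real_ball_space : (volume : Measure Space).real (Metric.ball 0 1) =
    Real.pi * 4 / 3 := by
  rw [Measure.real, EuclideanSpace.volume_ball_fin_three]
  simp
  positivity

theorem integral_radial (φ : ℝ → ℝ) :
    ∫ x : Space, φ ‖x‖ = 4 * Real.pi * ∫ r in Ioi 0, r ^ 2 * φ r := by
  rw [integral_fun_norm_addHaar, finrank_space, volume_real_ball_space]
  simp only [smul_eq_mul, nsmul_eq_mul]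
  push_cast
  ring

theorem norm_field_sq (f : Phase → ℝ) (x : Space) :
    ‖field f x‖ ^ 2 = (ballMass f ‖x‖ / ‖x‖ ^ 2) ^ 2 := by
  rcases eq_or_ne x 0 with rfl | hx
  · simp [field]
  · have : ‖x‖ ≠ 0 := norm_ne_zero_iff.2 hx
    rw [field, norm_smul, norm_smul, norm_inv, norm_norm, inv_mul_cancel₀ this, mul_one,
      Real.norm_eq_abs, sq_abs]

theorem integral_norm_field_sq (f : Phase → ℝ) :
    ∫ x : Space, ‖field f x‖ ^ 2 =
      4 * Real.pi * ∫ r in Ioi 0, ballMass f r * ballMass f r / r ^ 2 := by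
  simp only [norm_field_sq]
  rw [integral_radial fun r => (ballMass f r / r ^ 2) ^ 2]
  congr 1
  refine setIntegral_congr_fun measurableSet_Ioi fun r hr => ?_
  have : r ≠ 0 := ne_of_gt hr
  field_simp

namespace FiniteEnergy

variable {L0 : ℝ} {f h : Phase → ℝ}

theorem integral_inv_norm_mul_density (hL0 : 0 < L0) (hf : FiniteEnergy L0 f) (Mc : ℝ) :
    ∫ x : Space, Mc / ‖x‖ * density f x = Mc * ∫ z : Phase, ‖z.1‖⁻¹ * f z := by
  rw [Measure.volume_eq_prod, integral_prod _ (hf.integrable_inv_norm_mul hL0),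
    ← integral_const_mul]
  refine integral_congr_ae (ae_of_all _ fun x => ?_)
  simp only [integral_const_mul, density]
  ring

theorem potentialEnergy_eq (hL0 : 0 < L0) (hf : FiniteEnergy L0 f) (Mc : ℝ) :
    potentialEnergy Mc f =
      -(1 / 2) * (∫ r in Ioi 0, ballMass f r * ballMass f r / r ^ 2)
        - Mc * ∫ z : Phase, ‖z.1‖⁻¹ * f z := by
  rw [potentialEnergy, integral_norm_field_sq, hf.integral_inv_norm_mul_density hL0]
  field_simp
  ring

/-- The potential energy is concave: it lies below its linearization at `h`. -/
theorem potentialEnergy_le (hL0 : 0 < L0) (hf : FiniteEnergy L0 f) (hh : FiniteEnergy L0 h)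
    (Mc : ℝ) :
    potentialEnergy Mc f ≤ potentialEnergy Mc h
      + ((∫ z : Phase, potential h z.1 * f z) - Mc * ∫ z : Phase, ‖z.1‖⁻¹ * f z)
      - ((∫ z : Phase, potential h z.1 * h z) - Mc * ∫ z : Phase, ‖z.1‖⁻¹ * h z) := by
  rw [hf.potentialEnergy_eq hL0, hh.potentialEnergy_eq hL0, integral_potential_mul hL0 hf hh,
    integral_potential_mul hL0 hh hh]
  have hff := integrableOn_ballMass_mul hL0 hf hf
  have hhf := integrableOn_ballMass_mul hL0 hf hh
  have hhh := integrableOn_ballMass_mul hL0 hh hh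
  -- The gap between the potential energy and its linearization is half the integral of `(m_f -
  -- m_h)²/r²`.
  have key : 0 ≤ ∫ r in Ioi 0, (ballMass f r * ballMass f r / r ^ 2
      + ballMass h r * ballMass h r / r ^ 2 - 2 * (ballMass h r * ballMass f r / r ^ 2)) := by
    refine integral_nonneg fun r => ?_
    have : ballMass f r * ballMass f r / r ^ 2 + ballMass h r * ballMass h r / r ^ 2
        - 2 * (ballMass h r * ballMass f r / r ^ 2) = (ballMass f r - ballMass h r) ^ 2 / r ^ 2 := by
      ring
    simp only [this]
    positivity
  have hadd : IntegrableOn (fun r => ballMass f r * ballMass f r / r ^ 2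
      + ballMass h r * ballMass h r / r ^ 2) (Ioi 0) := hff.add hhh
  rw [integral_sub hadd (hhf.const_mul 2), integral_add hff hhh, integral_const_mul] at key
  linarith

end FiniteEnergy

/-! ### Shells in a fixed radial well: support and bounds -/

/-- A radial potential lying between `-A / |x|` and `0`. -/
structure RadialWell (A : ℝ) (U : Space → ℝ) : Prop where
  measurable : Measurable U
  radial : ∀ x y : Space, ‖x‖ = ‖y‖ → U x = U y
  nonpos : ∀ x, U x ≤ 0
  lower : ∀ x, x ≠ 0 → -(A / ‖x‖) ≤ U x

theorem FiniteEnergy.radialWell {L0 : ℝ} {f : Phase → ℝ} (hf : FiniteEnergy L0 f) :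
    RadialWell (∫ z, f z) (potential f) where
  measurable := hf.measurable_potential
  radial x y h := by simp only [potential, h]
  nonpos := hf.potential_nonpos
  lower _ hx := hf.neg_div_le_potential hx

variable {k l L0 Mc A E0 : ℝ} {U : Space → ℝ}

theorem shell_nonneg (hk : 0 < k) (z : Phase) : 0 ≤ shell k l L0 Mc E0 U z := by
  unfold shell
  positivity

theorem lt_of_shell_ne_zero (hk : 0 < k) (hl : 0 < l) {z : Phase}
    (hz : shell k l L0 Mc E0 U z ≠ 0) : L0 < angMomSq z ∧ particleEnergy Mc U z < E0 := by
  constructor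
  · by_contra h
    refine hz ?_
    rw [shell, max_eq_right (by linarith : angMomSq z - L0 ≤ 0), Real.zero_rpow hl.ne', mul_zero]
  · by_contra h
    refine hz ?_
    rw [shell, max_eq_right (by linarith : E0 - particleEnergy Mc U z ≤ 0),
      Real.zero_rpow hk.ne', mul_zero, zero_mul]

theorem norm_pos_of_lt_angMomSq (hL0 : 0 < L0) {z : Phase} (hz : L0 < angMomSq z) :
    0 < ‖z.1‖ := by
  refine norm_pos_iff.2 fun h => ?_
  have := angMomSq_le z
  rw [h, norm_zero] at this
  norm_num at this
  linarith

theorem RadialWell.half_sq_lt (hU : RadialWell A U) {z : Phase} (hz : z.1 ≠ 0)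
    (hE : particleEnergy Mc U z < E0) : (1 / 2) * ‖z.2‖ ^ 2 < E0 + (A + Mc) / ‖z.1‖ := by
  have := hU.lower _ hz
  rw [particleEnergy] at hE
  rw [add_div]
  linarith

/-- With `D = A + M_c` and `r = |x|`, the well gives `|v|² < 2D/r`, and the barrier `L₀ < r²|v|²`
then forces `L₀ < 2Dr`. This bound on `1/r` controls velocity and energy; `-E₀ ≤ D/r` bounds the
radius. -/
theorem RadialWell.support_bounds (hU : RadialWell A U) (hD : 0 < A + Mc) (hL0 : 0 < L0)
    (hE0 : E0 ≤ 0) {z : Phase} (hL : L0 < angMomSq z) (hE : particleEnergy Mc U z < E0) :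
    L0 / (2 * (A + Mc)) ≤ ‖z.1‖ ∧ -E0 * ‖z.1‖ ≤ A + Mc ∧ ‖z.2‖ ^ 2 ≤ 4 * (A + Mc) ^ 2 / L0 ∧
      E0 - particleEnergy Mc U z ≤ 2 * (A + Mc) ^ 2 / L0 := by
  have hr := norm_pos_of_lt_angMomSq hL0 hL
  have hv := hU.half_sq_lt (norm_pos_iff.1 hr) hE
  have hl := hU.lower _ (norm_pos_iff.1 hr)
  have hLr := hL.trans_le (angMomSq_le z)
  set D := A + Mc with hDdef
  set r := ‖z.1‖
  have hD' : D / r * r = D := div_mul_cancel₀ _ hr.ne'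
  have hDr : 0 < D / r := by positivity
  have hv2 : ‖z.2‖ ^ 2 < 2 * (D / r) := by linarith
  have h1 : L0 < 2 * D * r := by
    calc L0 < r ^ 2 * ‖z.2‖ ^ 2 := hLr
      _ ≤ r ^ 2 * (2 * (D / r)) := by gcongr
      _ = 2 * (D / r * r) * r := by ring
      _ = 2 * D * r := by rw [hD']
  have h2 : D / r ≤ 2 * D ^ 2 / L0 := by
    rw [div_le_div_iff₀ hr hL0]
    nlinarith
  refine ⟨?_, ?_, ?_, ?_⟩
  · rw [div_le_iff₀ (by positivity)]
    linarith
  · have : -E0 ≤ D / r := by nlinarith [sq_nonneg ‖z.2‖]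
    calc -E0 * r ≤ D / r * r := by gcongr
      _ = D := hD'
  · calc ‖z.2‖ ^ 2 ≤ 2 * (D / r) := hv2.le
      _ ≤ 2 * (2 * D ^ 2 / L0) := by gcongr
      _ = 4 * D ^ 2 / L0 := by ring
  · have hDD : A / r + Mc / r = D / r := by rw [hDdef, add_div]
    rw [particleEnergy]
    have := sq_nonneg ‖z.2‖
    linarith

theorem RadialWell.shell_eq_zero (hU : RadialWell A U) (hk : 0 < k) (hl : 0 < l) (hL0 : 0 < L0)
    (hE0 : E0 ≤ -((A + Mc) ^ 2 / (2 * L0))) (z : Phase) : shell k l L0 Mc E0 U z = 0 := by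
  by_contra h
  obtain ⟨hL, hE⟩ := lt_of_shell_ne_zero hk hl h
  have hr := norm_pos_of_lt_angMomSq hL0 hL
  have hv := hU.half_sq_lt (norm_pos_iff.1 hr) hE
  have hLr := hL.trans_le (angMomSq_le z)
  set D := A + Mc
  set r := ‖z.1‖
  have h1 : L0 < 2 * (E0 * r ^ 2 + D * r) := by
    have : D / r * r = D := div_mul_cancel₀ _ hr.ne'
    calc L0 < r ^ 2 * ‖z.2‖ ^ 2 := hLr
      _ ≤ r ^ 2 * (2 * (E0 + D / r)) := by gcongr; linarith
      _ = 2 * (E0 * r ^ 2 + (D / r * r) * r) := by ring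
      _ = _ := by rw [this]
  have h2 : E0 * (2 * L0) ≤ -D ^ 2 := by
    rw [← neg_div, le_div_iff₀ (by positivity)] at hE0
    exact hE0
  -- Multiplying `h1` by `L0` and inserting `h2` gives `(L0 - D r)² < 0`.
  nlinarith [sq_nonneg (L0 - D * r), mul_le_mul_of_nonneg_right h2 (sq_nonneg r)]

theorem measurable_particleEnergy (hU : RadialWell A U) : Measurable (particleEnergy Mc U) := by
  unfold particleEnergy
  have := hU.measurable
  fun_prop

theorem measurable_shell (hU : RadialWell A U) : Measurable (shell k l L0 Mc E0 U) := by
  unfold shell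
  have h1 : Measurable fun z => max (E0 - particleEnergy Mc U z) 0 :=
    (measurable_const.sub (measurable_particleEnergy hU)).max measurable_const
  have h2 : Measurable fun z => max (angMomSq z - L0) 0 :=
    (continuous_angMomSq.measurable.sub measurable_const).max measurable_const
  exact ((h1.pow_const k).const_mul _).mul (h2.pow_const l)

/-- Uniform bounds on the shells of energy at most `-e`. -/
theorem RadialWell.exists_shell_bound (hU : RadialWell A U) (hk : 0 < k) (hl : 0 < l)
    (hL0 : 0 < L0) (hD : 0 < A + Mc) {e : ℝ} (he : 0 < e) :
    ∃ R V C : ℝ, 0 ≤ C ∧ ∀ E0 ≤ -e, ∀ z : Phase, shell k l L0 Mc E0 U z ≤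
      (Metric.closedBall (0 : Space) R ×ˢ Metric.closedBall (0 : Space) V).indicator
        (fun _ => C) z := by
  set D := A + Mc
  set R := D / e
  set V := √(4 * D ^ 2 / L0)
  set C := (k / (k + 1)) ^ k * (2 * D ^ 2 / L0) ^ k * (R ^ 2 * V ^ 2) ^ l
  have hC : 0 ≤ C := by positivity
  refine ⟨R, V, C, hC, fun E0 hE0 z => ?_⟩
  by_cases hz : shell k l L0 Mc E0 U z = 0
  · rw [hz]
    exact indicator_apply_nonneg fun _ => hC
  obtain ⟨hL, hE⟩ := lt_of_shell_ne_zero hk hl hz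
  obtain ⟨-, h2, h3, h4⟩ := hU.support_bounds hD hL0 (by linarith) hL hE
  have hR : ‖z.1‖ ≤ R := by
    rw [le_div_iff₀ he]
    nlinarith [norm_nonneg z.1]
  have hV : ‖z.2‖ ≤ V := Real.le_sqrt_of_sq_le h3
  rw [indicator_of_mem (by simp [hR, hV])]
  have hLle := angMomSq_le z
  unfold shell C
  gcongr
  · exact max_le h4 (by positivity)
  · refine max_le ?_ (by positivity)
    calc angMomSq z - L0 ≤ ‖z.1‖ ^ 2 * ‖z.2‖ ^ 2 := by linarith
      _ ≤ _ := by gcongr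

theorem integrable_ball_indicator (R V C : ℝ) : Integrable
    ((Metric.closedBall (0 : Space) R ×ˢ Metric.closedBall (0 : Space) V).indicator
      fun _ : Phase => C) := by
  rw [integrable_indicator_iff (Metric.isClosed_closedBall.prod
    Metric.isClosed_closedBall).measurableSet]
  refine integrableOn_const ?_
  exact ((isCompact_closedBall _ _).prod (isCompact_closedBall _ _)).measure_lt_top.ne

theorem RadialWell.integrable_shell (hU : RadialWell A U) (hk : 0 < k) (hl : 0 < l)
    (hL0 : 0 < L0) (hD : 0 < A + Mc) (hE0 : E0 < 0) : Integrable (shell k l L0 Mc E0 U) := by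
  obtain ⟨R, V, C, hC, h⟩ := hU.exists_shell_bound hk hl hL0 hD (neg_pos.2 hE0)
  refine (integrable_ball_indicator R V C).mono' (measurable_shell hU).aestronglyMeasurable
    (ae_of_all _ fun z => ?_)
  rw [Real.norm_of_nonneg (shell_nonneg hk z)]
  exact h E0 (by simp) z

theorem continuous_shell_energy (hk : 0 < k) (z : Phase) :
    Continuous fun E0 => shell k l L0 Mc E0 U z := by
  unfold shell
  refine (continuous_const.mul ?_).mul continuous_const
  exact ((continuous_id.sub continuous_const).max continuous_const).rpow_const
    fun _ => Or.inr hk.le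

theorem monotone_shell_energy (hk : 0 < k) (z : Phase) :
    Monotone fun E0 => shell k l L0 Mc E0 U z := by
  intro E E' h
  simp only [shell]
  gcongr

theorem RadialWell.continuousOn_mass (hU : RadialWell A U) (hk : 0 < k) (hl : 0 < l)
    (hL0 : 0 < L0) (hD : 0 < A + Mc) :
    ContinuousOn (fun E0 => ∫ z, shell k l L0 Mc E0 U z) (Iio 0) := by
  intro E0 hE0
  refine ContinuousAt.continuousWithinAt ?_
  -- Energies below `E0 / 2` form a neighbourhood of `E0` that stays away from `0`, so a single
  -- dominating function serves them all.
  have he : 0 < -(E0 / 2) := by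
    have : E0 < 0 := hE0
    linarith
  obtain ⟨R, V, C, hC, h⟩ := hU.exists_shell_bound hk hl hL0 hD he
  refine continuousAt_of_dominated (Eventually.of_forall fun E =>
    (measurable_shell hU).aestronglyMeasurable) ?_ (integrable_ball_indicator R V C)
    (ae_of_all _ fun z => (continuous_shell_energy hk z).continuousAt)
  filter_upwards [Iio_mem_nhds (by linarith : E0 < E0 / 2)] with E hE
  refine ae_of_all _ fun z => ?_
  rw [Real.norm_of_nonneg (shell_nonneg hk z)]
  exact h E (by rw [neg_neg]; exact le_of_lt hE) z

/-! ### The mass of a shell as a function of its cut-off energy -/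

/-- A region of phase space invariant under the scalings `(x, v) ↦ (4 x, v / 2)`. -/
def scalingCone (Mc R : ℝ) : Set Phase :=
  {z | R < ‖z.1‖ ∧ ‖z.1‖ * ‖z.2‖ ^ 2 < Mc ∧ Mc * ‖z.1‖ < 8 * angMomSq z}

theorem isOpen_scalingCone (Mc R : ℝ) : IsOpen (scalingCone Mc R) := by
  have h := continuous_angMomSq
  have hset : scalingCone Mc R = {z : Phase | R < ‖z.1‖} ∩
      ({z : Phase | ‖z.1‖ * ‖z.2‖ ^ 2 < Mc} ∩ {z : Phase | Mc * ‖z.1‖ < 8 * angMomSq z}) := rfl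
  rw [hset]
  exact (isOpen_lt (by fun_prop) (by fun_prop)).inter
    ((isOpen_lt (by fun_prop) (by fun_prop)).inter (isOpen_lt (by fun_prop) (by fun_prop)))

theorem scalingCone_nonempty (hMc : 0 < Mc) (R : ℝ) : (scalingCone Mc R).Nonempty := by
  -- Take `x ⊥ v` with `|x| = r` and `|v|² = Mc / (2 r)`: then `|x||v|² = Mc / 2` and `8 L = 4 Mc
  -- r`.
  set r : ℝ := max R 0 + 1
  have hr : 0 < r := by positivity
  set s : ℝ := √(Mc / (2 * r))
  have hs : s ^ 2 = Mc / (2 * r) := Real.sq_sqrt (by positivity)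
  let e : Fin 3 → Space := fun i => EuclideanSpace.single i 1
  refine ⟨(r • e 0, s • e 1), ?_, ?_, ?_⟩
  · simp only [norm_smul, e, PiLp.norm_single, norm_one, mul_one,
      Real.norm_of_nonneg hr.le]
    exact lt_of_le_of_lt (le_max_left R 0) (lt_add_one _)
  · simp only [norm_smul, e, PiLp.norm_single, norm_one, mul_one,
      Real.norm_of_nonneg hr.le, Real.norm_eq_abs, sq_abs, hs]
    field_simp
    norm_num
  · simp only [angMomSq, norm_smul, e, PiLp.norm_single, norm_one, mul_one,
      Real.norm_of_nonneg hr.le, Real.norm_eq_abs, sq_abs, hs, inner_smul_left, inner_smul_right,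
      EuclideanSpace.inner_single_left]
    simp
    field_simp
    norm_num

theorem angMomSq_smul (a b : ℝ) (z : Phase) :
    angMomSq (a • z.1, b • z.2) = a ^ 2 * b ^ 2 * angMomSq z := by
  simp only [angMomSq, norm_smul, inner_smul_left, inner_smul_right, Real.norm_eq_abs, mul_pow,
    sq_abs, conj_trivial]
  ring

/-- The scaling maps the cone into itself with determinant `4³ · 2⁻³ = 8`, so a finite volume would
satisfy `8 · vol ≤ vol`; but the cone is open and nonempty. -/
theorem volume_scalingCone (hMc : 0 < Mc) {R : ℝ} (hR : 0 ≤ R) :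
    volume (scalingCone Mc R) = ⊤ := by
  let T : Phase →ₗ[ℝ] Phase :=
    LinearMap.prodMap ((4 : ℝ) • LinearMap.id) ((2⁻¹ : ℝ) • LinearMap.id)
  have hdet : LinearMap.det T = 8 := by
    rw [LinearMap.det_prodMap, LinearMap.det_smul, LinearMap.det_smul, finrank_space]
    norm_num
  have hsub : T '' scalingCone Mc R ⊆ scalingCone Mc R := by
    rintro _ ⟨z, ⟨h1, h2, h3⟩, rfl⟩
    have hT : T z = ((4 : ℝ) • z.1, (2⁻¹ : ℝ) • z.2) := rfl
    rw [hT]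
    refine ⟨?_, ?_, ?_⟩
    · simp only [norm_smul]
      norm_num
      linarith
    · simp only [norm_smul]
      norm_num
      linarith
    · rw [angMomSq_smul]
      simp only [norm_smul]
      norm_num
      linarith
  have hle := measure_mono (μ := volume) hsub
  have : (volume : Measure Phase).IsAddHaarMeasure :=
    inferInstanceAs ((volume : Measure Space).prod (volume : Measure Space)).IsAddHaarMeasure
  rw [Measure.addHaar_image_linearMap, hdet] at hle
  by_contra htop
  have hpos := (isOpen_scalingCone Mc R).measure_pos volume (scalingCone_nonempty hMc R)
  have h := ENNReal.toReal_mono htop hle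
  have hp : 0 < (volume (scalingCone Mc R)).toReal := ENNReal.toReal_pos hpos.ne' htop
  rw [ENNReal.toReal_mul, ENNReal.toReal_ofReal (by norm_num)] at h
  norm_num at h
  linarith

/-- On the cone `-E ≥ M_c/(2r)`, and `r > 16 L₀/M_c` turns `L > M_c r/8` into `L - L₀ ≥ M_c r/16`.
The shell is then at least a constant times `r^(l-k)`, and `r^(l-k) ≥ 1` because `r > 1` and `k ≤
l`. -/
theorem RadialWell.shell_zero_lower (hU : RadialWell A U) (hk : 0 < k) (hkl : k ≤ l) (hMc : 0 < Mc)
    {z : Phase} (hz : z ∈ scalingCone Mc (max 1 (16 * L0 / Mc))) :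
    (k / (k + 1)) ^ k * (Mc / 2) ^ k * (Mc / 16) ^ l ≤ shell k l L0 Mc 0 U z := by
  obtain ⟨h1, h2, h3⟩ := hz
  have hr1 : 1 < ‖z.1‖ := (le_max_left _ _).trans_lt h1
  have hr2 : 16 * L0 / Mc < ‖z.1‖ := (le_max_right _ _).trans_lt h1
  have hU0 := hU.nonpos z.1
  set r := ‖z.1‖ with hr
  have hr0 : 0 < r := one_pos.trans hr1
  rw [div_lt_iff₀ hMc] at hr2
  have hE : Mc / 2 * r⁻¹ ≤ max (0 - particleEnergy Mc U z) 0 := by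
    refine le_max_of_le_left ?_
    have hv : ‖z.2‖ ^ 2 ≤ Mc * r⁻¹ := by
      rw [← div_eq_mul_inv, le_div_iff₀ hr0]
      linarith
    rw [particleEnergy, ← hr, div_eq_mul_inv Mc r]
    linarith
  have hL : Mc / 16 * r ≤ max (angMomSq z - L0) 0 := le_max_of_le_left (by linarith)
  have hrr : 1 ≤ (r⁻¹) ^ k * r ^ l := by
    rw [Real.inv_rpow hr0.le, ← Real.rpow_neg hr0.le, ← Real.rpow_add hr0]
    exact Real.one_le_rpow hr1.le (by linarith)
  have hl : 0 < l := hk.trans_le hkl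
  calc (k / (k + 1)) ^ k * (Mc / 2) ^ k * (Mc / 16) ^ l
      ≤ (k / (k + 1)) ^ k * (Mc / 2) ^ k * (Mc / 16) ^ l * ((r⁻¹) ^ k * r ^ l) :=
        le_mul_of_one_le_right (by positivity) hrr
    _ = (k / (k + 1)) ^ k * (Mc / 2 * r⁻¹) ^ k * (Mc / 16 * r) ^ l := by
        rw [Real.mul_rpow (by positivity) (by positivity),
          Real.mul_rpow (by positivity) (by positivity)]
        ring
    _ ≤ _ := by
        unfold shell
        gcongr

theorem RadialWell.lintegral_shell_zero (hU : RadialWell A U) (hk : 0 < k) (hkl : k ≤ l)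
    (hMc : 0 < Mc) : ∫⁻ z, ENNReal.ofReal (shell k l L0 Mc 0 U z) = ⊤ := by
  set S := scalingCone Mc (max 1 (16 * L0 / Mc))
  set c := (k / (k + 1)) ^ k * (Mc / 2) ^ k * (Mc / 16) ^ l
  have hc : 0 < c := by positivity
  rw [eq_top_iff]
  calc (⊤ : ENNReal) = ENNReal.ofReal c * volume S := by
        rw [volume_scalingCone hMc (by positivity), ENNReal.mul_top (by simpa using hc)]
    _ = ∫⁻ _ in S, ENNReal.ofReal c := by rw [setLIntegral_const]
    _ ≤ ∫⁻ z in S, ENNReal.ofReal (shell k l L0 Mc 0 U z) :=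
        setLIntegral_mono' (isOpen_scalingCone _ _).measurableSet fun z hz =>
          ENNReal.ofReal_le_ofReal (hU.shell_zero_lower hk hkl hMc hz)
    _ ≤ _ := setLIntegral_le_lintegral _ _

/-- Monotone convergence along `E₀ = -1/(n+1)`: masses bounded by `M` would bound the infinite mass
at `E₀ = 0`. -/
theorem RadialWell.exists_mass_ge (hU : RadialWell A U) (hk : 0 < k) (hkl : k ≤ l)
    (hL0 : 0 < L0) (hMc : 0 < Mc) (hA : 0 ≤ A) (M : ℝ) :
    ∃ E0 < 0, M ≤ ∫ z, shell k l L0 Mc E0 U z := by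
  by_contra! hcon
  have hseq : ∀ n : ℕ, -(1 / ((n : ℝ) + 1)) < 0 := fun n => by
    rw [neg_lt_zero]
    positivity
  have hlim : Tendsto (fun n : ℕ => -(1 / ((n : ℝ) + 1))) atTop (𝓝 0) := by
    simpa using (tendsto_one_div_add_atTop_nhds_zero_nat (𝕜 := ℝ)).neg
  have hmono : Monotone fun n : ℕ => -(1 / ((n : ℝ) + 1)) := by
    intro m n hmn
    simp only [neg_le_neg_iff]
    gcongr
  have h := lintegral_tendsto_of_tendsto_of_monotone (μ := (volume : Measure Phase))
    (f := fun n z => ENNReal.ofReal (shell k l L0 Mc (-(1 / ((n : ℝ) + 1))) U z))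
    (F := fun z => ENNReal.ofReal (shell k l L0 Mc 0 U z))
    (fun n => (measurable_shell hU).ennreal_ofReal.aemeasurable)
    (ae_of_all _ fun z m n hmn =>
      ENNReal.ofReal_le_ofReal (monotone_shell_energy hk z (hmono hmn)))
    (ae_of_all _ fun z => (ENNReal.continuous_ofReal.tendsto _).comp
      (((continuous_shell_energy hk z).tendsto 0).comp hlim))
  rw [hU.lintegral_shell_zero hk hkl hMc] at h
  have hle := le_of_tendsto' h (b := ENNReal.ofReal M) fun n => by
    rw [← ofReal_integral_eq_lintegral_ofReal
      (hU.integrable_shell hk (hk.trans_le hkl) hL0 (by positivity) (hseq n))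
      (ae_of_all _ fun z => shell_nonneg hk z)]
    exact ENNReal.ofReal_le_ofReal (hcon _ (hseq n)).le
  simp at hle

/-- Every positive mass is attained by a shell of negative cut-off energy. -/
theorem RadialWell.exists_mass_eq (hU : RadialWell A U) (hk : 0 < k) (hkl : k ≤ l)
    (hL0 : 0 < L0) (hMc : 0 < Mc) (hA : 0 ≤ A) {M : ℝ} (hM : 0 < M) :
    ∃ E0 < 0, ∫ z, shell k l L0 Mc E0 U z = M := by
  have hl := hk.trans_le hkl
  obtain ⟨E1, hE1, h1⟩ := hU.exists_mass_ge hk hkl hL0 hMc hA M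
  set E2 := -((A + Mc) ^ 2 / (2 * L0))
  have h2 : ∫ z, shell k l L0 Mc E2 U z = 0 := by
    simp [hU.shell_eq_zero hk hl hL0 (le_refl E2)]
  have hE : E2 ≤ E1 := by
    by_contra! hlt
    have : ∫ z, shell k l L0 Mc E1 U z = 0 := by
      simp [hU.shell_eq_zero hk hl hL0 hlt.le]
    linarith
  obtain ⟨E0, hE0, h⟩ := intermediate_value_Icc hE
    ((hU.continuousOn_mass hk hl hL0 (by positivity)).mono
      fun E hE => lt_of_le_of_lt hE.2 hE1) (show M ∈ Icc _ _ from ⟨h2.le.trans hM.le, h1⟩)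
  exact ⟨E0, hE0.2.trans_lt hE1, h⟩

/-! ### Pointwise minimization and identification of the minimizer -/

/-- The integrand of the Casimir functional. -/
noncomputable def casimirDensity (k l L0 : ℝ) (z : Phase) (y : ℝ) : ENNReal :=
  ENNReal.ofReal y ^ (1 + 1 / k) * ENNReal.ofReal (angMomSq z - L0) ^ (-(l / k))

theorem casimirDensity_toReal {z : Phase} (hz : L0 < angMomSq z) {y : ℝ} (hy : 0 ≤ y) :
    (casimirDensity k l L0 z y).toReal = y ^ (1 + 1 / k) * (angMomSq z - L0) ^ (-(l / k)) := by
  rw [casimirDensity, ENNReal.toReal_mul, ← ENNReal.toReal_rpow, ← ENNReal.toReal_rpow,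
    ENNReal.toReal_ofReal hy, ENNReal.toReal_ofReal (by linarith)]

theorem casimirDensity_ne_top (hk : 0 < k) {z : Phase} (hz : L0 < angMomSq z) (y : ℝ) :
    casimirDensity k l L0 z y ≠ ⊤ := by
  refine ENNReal.mul_ne_top (ENNReal.rpow_ne_top_of_nonneg (by positivity) ENNReal.ofReal_ne_top) ?_
  exact ENNReal.rpow_ne_top_of_ne_zero (by simpa using hz) ENNReal.ofReal_ne_top

theorem casimirDensity_zero (hk : 0 < k) (z : Phase) : casimirDensity k l L0 z 0 = 0 := by
  rw [casimirDensity, ENNReal.ofReal_zero, ENNReal.zero_rpow_of_pos (by positivity), zero_mul]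

theorem eq_zero_of_casimirDensity_lt_top (hk : 0 < k) (hl : 0 < l) {z : Phase}
    (hz : angMomSq z ≤ L0) {y : ℝ} (hy : 0 ≤ y) (h : casimirDensity k l L0 z y < ⊤) : y = 0 := by
  by_contra hne
  have hpos : 0 < y := lt_of_le_of_ne hy (Ne.symm hne)
  refine h.ne ?_
  rw [casimirDensity, ENNReal.ofReal_of_nonpos (by linarith : angMomSq z - L0 ≤ 0),
    ENNReal.zero_rpow_of_neg (by rw [neg_lt_zero]; positivity), ENNReal.mul_top]
  rw [Ne, ENNReal.rpow_eq_zero_iff]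
  simp [hpos]

theorem measurable_casimirDensity :
    Measurable fun p : Phase × ℝ => casimirDensity k l L0 p.1 p.2 := by
  unfold casimirDensity
  have := continuous_angMomSq.measurable
  fun_prop

/-- This is the Euler–Lagrange relation `(1 + 1/k) g^(1/k) (L - L₀)^(-l/k) = (E₀ - E)₊` multiplied
by `g`; it accounts for the factor `(k/(k+1))^k`. -/
theorem shell_rpow_mul (hk : 0 < k) {z : Phase} (hz : L0 < angMomSq z) :
    shell k l L0 Mc E0 U z ^ (1 + 1 / k) * (angMomSq z - L0) ^ (-(l / k)) =
      k / (k + 1) * max (E0 - particleEnergy Mc U z) 0 * shell k l L0 Mc E0 U z := by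
  have hm : 0 < angMomSq z - L0 := by linarith
  set g := shell k l L0 Mc E0 U z with hg
  have hg0 : 0 ≤ g := shell_nonneg hk z
  set a := max (E0 - particleEnergy Mc U z) 0 with ha
  have ha0 : 0 ≤ a := le_max_right _ _
  have hroot : g ^ (1 / k) = k / (k + 1) * a * (angMomSq z - L0) ^ (l / k) := by
    rw [hg, shell, max_eq_left hm.le, ← ha, Real.mul_rpow (by positivity) (by positivity),
      Real.mul_rpow (by positivity) (by positivity), ← Real.rpow_mul (by positivity),
      ← Real.rpow_mul ha0, ← Real.rpow_mul hm.le, mul_one_div, div_self hk.ne', mul_one_div,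
      Real.rpow_one, Real.rpow_one]
  rw [Real.rpow_add_of_nonneg hg0 zero_le_one (by positivity), Real.rpow_one, hroot,
    Real.rpow_neg hm.le]
  have : (angMomSq z - L0) ^ (l / k) ≠ 0 := (Real.rpow_pos_of_pos hm _).ne'
  field_simp

/-- The shell is the strict pointwise minimizer of the linearized energy-Casimir density. -/
theorem shell_strict_min (hk : 0 < k) {z : Phase} (hz : L0 < angMomSq z) {y : ℝ} (hy : 0 ≤ y)
    (hne : y ≠ shell k l L0 Mc E0 U z) :
    shell k l L0 Mc E0 U z ^ (1 + 1 / k) * (angMomSq z - L0) ^ (-(l / k))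
      + (particleEnergy Mc U z - E0) * shell k l L0 Mc E0 U z <
    y ^ (1 + 1 / k) * (angMomSq z - L0) ^ (-(l / k)) + (particleEnergy Mc U z - E0) * y := by
  have hm : 0 < angMomSq z - L0 := by linarith
  have hw : 0 < (angMomSq z - L0) ^ (-(l / k)) := Real.rpow_pos_of_pos hm _
  rcases le_or_gt (E0 - particleEnergy Mc U z) 0 with ha | ha
  · have hg : shell k l L0 Mc E0 U z = 0 := by
      rw [shell, max_eq_right ha, Real.zero_rpow hk.ne', mul_zero, zero_mul]
    rw [hg] at hne ⊢
    have hy0 : 0 < y := lt_of_le_of_ne hy hne.symm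
    rw [Real.zero_rpow (by positivity)]
    have : 0 < y ^ (1 + 1 / k) := Real.rpow_pos_of_pos hy0 _
    nlinarith [mul_pos this hw]
  · have hid := shell_rpow_mul (l := l) (Mc := Mc) (E0 := E0) (U := U) hk hz
    have hg : 0 < shell k l L0 Mc E0 U z := by
      rw [shell, max_eq_left ha.le, max_eq_left hm.le]
      positivity
    rw [max_eq_left ha.le] at hid
    set g := shell k l L0 Mc E0 U z
    set a := E0 - particleEnergy Mc U z with ha_def
    -- Strict Bernoulli inequality in the ratio `y / g`, i.e. strict convexity of the Casimir
    -- integrand around its critical point `g`.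
    have hb : 1 + (1 + 1 / k) * (y / g - 1) < (y / g) ^ (1 + 1 / k) := by
      have h1 : (-1 : ℝ) ≤ y / g - 1 := by
        have : 0 ≤ y / g := by positivity
        linarith
      have h2 : y / g - 1 ≠ 0 := by
        rw [sub_ne_zero, Ne, div_eq_one_iff_eq hg.ne']
        exact hne
      have h3 : (1 : ℝ) < 1 + 1 / k := by
        have : 0 < 1 / k := by positivity
        linarith
      simpa using one_add_mul_self_lt_rpow_one_add h1 h2 h3
    have hyp : y ^ (1 + 1 / k) * (angMomSq z - L0) ^ (-(l / k)) =
        k / (k + 1) * a * g * (y / g) ^ (1 + 1 / k) := by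
      rw [← hid, Real.div_rpow hy hg.le]
      have : g ^ (1 + 1 / k) ≠ 0 := (Real.rpow_pos_of_pos hg _).ne'
      field_simp
    have hEa : particleEnergy Mc U z - E0 = -a := by rw [ha_def]; ring
    rw [hid, hyp, hEa]
    have hc : 0 < k / (k + 1) * a * g := by positivity
    have hlt := mul_lt_mul_of_pos_left hb hc
    have hexp : k / (k + 1) * a * g * (1 + (1 + 1 / k) * (y / g - 1)) =
        k / (k + 1) * a * g + a * y - a * g := by
      field_simp
      ring
    linarith

theorem angMomSq_map (T : Space ≃ₗᵢ[ℝ] Space) (x v : Space) :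
    angMomSq (T x, T v) = angMomSq (x, v) := by
  simp [angMomSq]

theorem RadialWell.shell_map (hU : RadialWell A U) (T : Space ≃ₗᵢ[ℝ] Space) (x v : Space) :
    shell k l L0 Mc E0 U (T x, T v) = shell k l L0 Mc E0 U (x, v) := by
  simp [shell, angMomSq_map, particleEnergy, hU.radial (T x) x (by simp)]

/-- On the support `|v|²` and `E₀ - E` are bounded, so the kinetic and Casimir integrands are
dominated by multiples of the integrable shell itself. -/
theorem RadialWell.shell_mem_admissible (hU : RadialWell A U) (hk : 0 < k) (hl : 0 < l)
    (hL0 : 0 < L0) (hD : 0 < A + Mc) (hE0 : E0 < 0) :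
    shell k l L0 Mc E0 U ∈ admissible k l L0 (∫ z, shell k l L0 Mc E0 U z) := by
  have hint := hU.integrable_shell hk hl hL0 hD hE0 (k := k) (l := l)
  refine ⟨hint, ae_of_all _ fun z => shell_nonneg hk z,
    ⟨_, measurable_shell hU, EventuallyEq.rfl, hU.shell_map⟩, rfl, ?_, ae_of_all _ fun z hz => ?_⟩
  · set D := A + Mc
    have hfin : ∀ c : ℝ, ∫⁻ z, ENNReal.ofReal (c * shell k l L0 Mc E0 U z) < ⊤ :=
      fun c => (hint.const_mul c).lintegral_lt_top
    refine ENNReal.add_lt_top.2 ⟨?_, ?_⟩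
    · refine lt_of_le_of_lt (lintegral_mono fun z => ENNReal.ofReal_le_ofReal ?_)
        (hfin ((1 / 2) * (4 * D ^ 2 / L0)))
      by_cases hz : shell k l L0 Mc E0 U z = 0
      · simp [hz]
      obtain ⟨hL, hE⟩ := lt_of_shell_ne_zero hk hl hz
      have h3 := (hU.support_bounds hD hL0 hE0.le hL hE).2.2.1
      have := shell_nonneg (l := l) (L0 := L0) (Mc := Mc) (E0 := E0) (U := U) hk z
      gcongr
    · refine lt_of_le_of_lt (lintegral_mono fun z => ?_)
        (hfin (k / (k + 1) * (2 * D ^ 2 / L0)))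
      change casimirDensity k l L0 z _ ≤ _
      by_cases hz : shell k l L0 Mc E0 U z = 0
      · rw [hz, casimirDensity_zero hk]
        exact zero_le
      obtain ⟨hL, hE⟩ := lt_of_shell_ne_zero hk hl hz
      have h4 := (hU.support_bounds hD hL0 hE0.le hL hE).2.2.2
      have hs := shell_nonneg (l := l) (L0 := L0) (Mc := Mc) (E0 := E0) (U := U) hk z
      rw [← ENNReal.ofReal_toReal (casimirDensity_ne_top hk hL _), casimirDensity_toReal hL hs,
        shell_rpow_mul hk hL]
      refine ENNReal.ofReal_le_ofReal ?_
      gcongr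
      exact max_le h4 (by positivity)
  · by_contra h
    exact absurd (lt_of_shell_ne_zero hk hl h).1 (not_lt.2 hz.le)

/-- The Casimir integrand of an admissible density is finite almost everywhere, and integrable. -/
theorem admissible.integrable_casimir {M : ℝ} {f : Phase → ℝ} (hf : f ∈ admissible k l L0 M) :
    Integrable (fun z => (casimirDensity k l L0 z (f z)).toReal) ∧
    ∫ z, (casimirDensity k l L0 z (f z)).toReal = (casimir k l L0 f).toReal ∧
    ∀ᵐ z, casimirDensity k l L0 z (f z) < ⊤ := by
  have hm : AEMeasurable fun z => casimirDensity k l L0 z (f z) :=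
    measurable_casimirDensity.comp_aemeasurable
      (aemeasurable_id.prodMk hf.1.aestronglyMeasurable.aemeasurable)
  have hfin : ∫⁻ z, casimirDensity k l L0 z (f z) ≠ ⊤ := (admissible.casimir_lt_top hf).ne
  have hlt := ae_lt_top' hm hfin
  exact ⟨integrable_toReal_of_lintegral_ne_top hm hfin, integral_toReal hm hlt, hlt⟩

/-- A minimizer of the energy-Casimir functional is a shell in its own potential. -/
theorem minimizer_ae_eq_shell {M : ℝ} {f0 : Phase → ℝ} (hk : 0 < k) (hl : 0 < l) (hL0 : 0 < L0)
    (hf0 : f0 ∈ admissible k l L0 M)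
    (hmin : IsMinOn (energyCasimir k l L0 Mc) (admissible k l L0 M) f0)
    (hg : shell k l L0 Mc E0 (potential f0) ∈ admissible k l L0 M) :
    f0 =ᵐ[volume] shell k l L0 Mc E0 (potential f0) := by
  set g := shell k l L0 Mc E0 (potential f0)
  have hF := admissible.finiteEnergy hf0
  have hG := admissible.finiteEnergy hg
  obtain ⟨-, -, hFfin⟩ := admissible.integrable_casimir hf0
  -- The integrand of the energy-Casimir functional linearized at `f0` in its potential part, with
  -- `E0` as multiplier for the mass constraint.
  let J : (Phase → ℝ) → Phase → ℝ := fun f z =>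
    (casimirDensity k l L0 z (f z)).toReal + (1 / 2) * ‖z.2‖ ^ 2 * f z + potential f0 z.1 * f z
      - Mc * (‖z.1‖⁻¹ * f z) - E0 * f z
  have hJ : ∀ f, f ∈ admissible k l L0 M → Integrable (J f) ∧
      ∫ z, J f z = (casimir k l L0 f).toReal + (kineticEnergy f).toReal
        + (∫ z : Phase, potential f0 z.1 * f z) - Mc * (∫ z : Phase, ‖z.1‖⁻¹ * f z) - E0 * M := by
    intro f hf
    have hE := admissible.finiteEnergy hf
    obtain ⟨h1, h1', -⟩ := admissible.integrable_casimir hf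
    have h2 := hE.kinetic
    have h3 := hE.integrable_potential_mul hL0 hF
    have h4 := (hE.integrable_inv_norm_mul hL0).const_mul Mc
    have h5 := hE.integrable.const_mul E0
    have h12 := h1.add h2
    have h123 := h12.add h3
    have h1234 := h123.sub h4
    refine ⟨h1234.sub h5, ?_⟩
    have e : J f = (((fun z => (casimirDensity k l L0 z (f z)).toReal)
      + (fun z : Phase => (1 / 2) * ‖z.2‖ ^ 2 * f z) + fun z : Phase => potential f0 z.1 * f z)
      - fun z : Phase => Mc * (‖z.1‖⁻¹ * f z)) - fun z => E0 * f z := rfl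
    rw [e, integral_sub' h1234 h5, integral_sub' h123 h4, integral_add' h12 h3,
      integral_add' h1 h2, h1', integral_const_mul, integral_const_mul, hE.kineticEnergy_toReal,
      hf.2.2.2.1]
  obtain ⟨hJF, hJF'⟩ := hJ f0 hf0
  obtain ⟨hJG, hJG'⟩ := hJ g hg
  have hpot := hG.potentialEnergy_le hL0 hF Mc
  have hle : energyCasimir k l L0 Mc f0 ≤ energyCasimir k l L0 Mc g := hmin hg
  simp only [energyCasimir] at hle
  -- Minimality is added to concavity; the terms `E0 * M` cancel because both masses equal `M`.
  have hJle : ∫ z, J f0 z ≤ ∫ z, J g z := by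
    rw [hJF', hJG']
    linarith
  have hJeq : ∀ f z, L0 < angMomSq z → 0 ≤ f z → J f z =
      f z ^ (1 + 1 / k) * (angMomSq z - L0) ^ (-(l / k))
        + (particleEnergy Mc (potential f0) z - E0) * f z := by
    intro f z hz hfz
    simp only [J, casimirDensity_toReal hz hfz, particleEnergy]
    ring
  have hpt : ∀ᵐ z, f0 z ≠ g z → J g z < J f0 z := by
    filter_upwards [hF.nonneg, hFfin] with z h0 hfin hne
    rcases le_or_gt (angMomSq z) L0 with hz | hz
    · refine absurd ?_ hne
      rw [eq_zero_of_casimirDensity_lt_top hk hl hz h0 hfin]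
      by_contra h
      exact absurd (lt_of_shell_ne_zero hk hl (Ne.symm h)).1 (not_lt.2 hz)
    · rw [hJeq f0 z hz h0, hJeq g z hz (shell_nonneg hk z)]
      exact shell_strict_min hk hz h0 hne
  have hnn : 0 ≤ᵐ[volume] fun z => J f0 z - J g z := by
    filter_upwards [hpt] with z hz
    by_cases h : f0 z = g z
    · simp [J, h]
    · exact (sub_pos.2 (hz h)).le
  have hzero : ∫ z, (J f0 z - J g z) = 0 := by
    refine le_antisymm ?_ (integral_nonneg_of_ae hnn)
    rw [integral_sub hJF hJG]
    linarith
  rw [integral_eq_zero_iff_of_nonneg_ae hnn (hJF.sub hJG)] at hzero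
  filter_upwards [hpt, hzero] with z hz h0
  by_contra hne
  have := hz hne
  simp only [Pi.zero_apply] at h0
  linarith

/-! ### Potentials of continuous radial densities vanishing near the origin -/

/-- The mass in the ball of radius `r` of a radial density with profile `ρ`. -/
noncomputable def radialMass (ρ : ℝ → ℝ) (r : ℝ) : ℝ :=
  ∫ s in (0 : ℝ)..r, 4 * Real.pi * (s ^ 2 * ρ s)

section Radial

variable {ρ : ℝ → ℝ} {ε : ℝ}

theorem hasDerivAt_radialMass (hρ : Continuous ρ) (r : ℝ) :
    HasDerivAt (radialMass ρ) (4 * Real.pi * (r ^ 2 * ρ r)) r :=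
  (Continuous.integral_hasStrictDerivAt (by fun_prop) 0 r).hasDerivAt

theorem radialMass_eq_zero (h0 : ∀ s, |s| < ε → ρ s = 0) {r : ℝ} (hr : |r| < ε) :
    radialMass ρ r = 0 := by
  rw [radialMass]
  refine (intervalIntegral.integral_congr (g := fun _ => 0) fun s hs => ?_).trans (by simp)
  have : |s| ≤ |r| := by simpa using abs_sub_left_of_mem_uIcc hs
  simp [h0 s (this.trans_lt hr)]

theorem contDiff_radialMass (hρ : Continuous ρ) : ContDiff ℝ 1 (radialMass ρ) := by
  rw [contDiff_one_iff_deriv]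
  refine ⟨fun r => (hasDerivAt_radialMass hρ r).differentiableAt, ?_⟩
  rw [funext fun r => (hasDerivAt_radialMass hρ r).deriv]
  fun_prop

/-- The mass vanishes identically near `0`, so dividing by `r ^ n` creates no singularity. The case
`n = 2` is the radial field, `n = 3` the coefficient of `x` in the gradient. -/
theorem contDiff_radialMass_div_pow (hρ : Continuous ρ) (hε : 0 < ε)
    (h0 : ∀ s, |s| < ε → ρ s = 0) (n : ℕ) : ContDiff ℝ 1 fun r => radialMass ρ r / r ^ n := by
  rw [contDiff_iff_contDiffAt]
  intro r
  by_cases hr : r = 0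
  · have : (fun r => radialMass ρ r / r ^ n) =ᶠ[𝓝 r] fun _ => 0 := by
      have hnhds : {s : ℝ | |s| < ε} ∈ 𝓝 r :=
        (isOpen_lt continuous_abs continuous_const).mem_nhds (by simp [hr, hε])
      filter_upwards [hnhds] with s hs
      rw [radialMass_eq_zero h0 hs, zero_div]
    exact contDiffAt_const.congr_of_eventuallyEq this
  · exact (contDiff_radialMass hρ).contDiffAt.div (by fun_prop) (pow_ne_zero n hr)

/-- The potential, as a function of the radius, of a radial density with profile `ρ`. -/
noncomputable def radialPotential (ρ : ℝ → ℝ) (c r : ℝ) : ℝ :=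
  c + ∫ s in (0 : ℝ)..r, radialMass ρ s / s ^ 2

theorem hasDerivAt_radialPotential (hρ : Continuous ρ) (hε : 0 < ε)
    (h0 : ∀ s, |s| < ε → ρ s = 0) (c r : ℝ) :
    HasDerivAt (radialPotential ρ c) (radialMass ρ r / r ^ 2) r :=
  (Continuous.integral_hasStrictDerivAt
    (contDiff_radialMass_div_pow hρ hε h0 2).continuous 0 r).hasDerivAt.const_add c

theorem contDiff_radialPotential (hρ : Continuous ρ) (hε : 0 < ε)
    (h0 : ∀ s, |s| < ε → ρ s = 0) (c : ℝ) : ContDiff ℝ 2 (radialPotential ρ c) := by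
  rw [show (2 : WithTop ℕ∞) = 1 + 1 from one_add_one_eq_two.symm, contDiff_succ_iff_deriv]
  refine ⟨fun r => (hasDerivAt_radialPotential hρ hε h0 c r).differentiableAt, by simp, ?_⟩
  rw [funext fun r => (hasDerivAt_radialPotential hρ hε h0 c r).deriv]
  exact contDiff_radialMass_div_pow hρ hε h0 2

theorem radialPotential_eq (h0 : ∀ s, |s| < ε → ρ s = 0) {r : ℝ} (hr : |r| < ε)
    (c : ℝ) : radialPotential ρ c r = c := by
  rw [radialPotential]
  refine add_eq_left.2 ?_
  refine (intervalIntegral.integral_congr (g := fun _ => 0) fun s hs => ?_).trans (by simp)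
  have : |s| ≤ |r| := by simpa using abs_sub_left_of_mem_uIcc hs
  simp [radialMass_eq_zero h0 (this.trans_lt hr)]

theorem norm_lt_mem_nhds_zero (hε : 0 < ε) : {y : Space | ‖y‖ < ε} ∈ 𝓝 (0 : Space) :=
  (isOpen_lt continuous_norm continuous_const).mem_nhds (by simpa using hε)

theorem contDiff_radialPotential_norm (hρ : Continuous ρ) (hε : 0 < ε)
    (h0 : ∀ s, |s| < ε → ρ s = 0) (c : ℝ) :
    ContDiff ℝ 2 fun x : Space => radialPotential ρ c ‖x‖ := by
  rw [contDiff_iff_contDiffAt]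
  intro x
  rcases eq_or_ne x 0 with rfl | hx
  · refine (contDiffAt_const (c := c)).congr_of_eventuallyEq ?_
    filter_upwards [norm_lt_mem_nhds_zero hε] with y hy
    exact radialPotential_eq h0 (by rwa [abs_norm]) c
  · exact (contDiff_radialPotential hρ hε h0 c).contDiffAt.comp x (contDiffAt_norm ℝ hx)

theorem hasGradientAt_norm {x : Space} (hx : x ≠ 0) :
    HasGradientAt (fun y : Space => ‖y‖) (‖x‖⁻¹ • x) x := by
  have hr : ‖x‖ ≠ 0 := norm_ne_zero_iff.2 hx
  rw [hasGradientAt_iff_hasFDerivAt]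
  have h := (hasStrictFDerivAt_norm_sq x).hasFDerivAt.sqrt (pow_ne_zero 2 hr)
  simp only [Real.sqrt_sq (norm_nonneg _)] at h
  refine h.congr_fderiv ?_
  ext y
  simp
  field_simp

theorem hasGradientAt_comp_norm {φ : ℝ → ℝ} {φ' : ℝ} {x : Space} (hx : x ≠ 0)
    (hφ : HasDerivAt φ φ' ‖x‖) :
    HasGradientAt (fun y : Space => φ ‖y‖) ((φ' / ‖x‖) • x) x := by
  have h := hφ.comp_hasFDerivAt x (hasGradientAt_iff_hasFDerivAt.1 (hasGradientAt_norm hx))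
  rw [hasGradientAt_iff_hasFDerivAt]
  refine HasFDerivAt.congr_fderiv h ?_
  ext y
  simp [div_eq_mul_inv, mul_assoc]

theorem hasGradientAt_radialPotential (hρ : Continuous ρ) (hε : 0 < ε)
    (h0 : ∀ s, |s| < ε → ρ s = 0) (c : ℝ) (x : Space) :
    HasGradientAt (fun y : Space => radialPotential ρ c ‖y‖)
      ((radialMass ρ ‖x‖ / ‖x‖ ^ 3) • x) x := by
  rcases eq_or_ne x 0 with rfl | hx
  · rw [smul_zero]
    refine (hasGradientAt_const (0 : Space) c).congr_of_eventuallyEq ?_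
    filter_upwards [norm_lt_mem_nhds_zero hε] with y hy
    exact radialPotential_eq h0 (by rwa [abs_norm]) c
  · convert hasGradientAt_comp_norm hx (hasDerivAt_radialPotential hρ hε h0 c ‖x‖) using 2
    rw [div_div]
    ring

theorem fderiv_radialPotential_apply (hρ : Continuous ρ) (hε : 0 < ε)
    (h0 : ∀ s, |s| < ε → ρ s = 0) (c : ℝ) (x e : Space) :
    fderiv ℝ (fun y : Space => radialPotential ρ c ‖y‖) x e =
      radialMass ρ ‖x‖ / ‖x‖ ^ 3 * inner ℝ x e := by
  rw [(hasGradientAt_iff_hasFDerivAt.1 (hasGradientAt_radialPotential hρ hε h0 c x)).fderiv]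
  simp

/-- Differentiate `(m/r³)(x · e)` in the direction `e`, using `m' = 4πr²ρ`. Summed over an
orthonormal basis, the two `3m/r³` contributions cancel and leave `4πρ`. -/
theorem second_fderiv_radialPotential (hρ : Continuous ρ) (hε : 0 < ε)
    (h0 : ∀ s, |s| < ε → ρ s = 0) (c : ℝ) {x : Space} (hx : x ≠ 0) (e : Space) :
    fderiv ℝ (fderiv ℝ fun y : Space => radialPotential ρ c ‖y‖) x e e =
      radialMass ρ ‖x‖ / ‖x‖ ^ 3 * ‖e‖ ^ 2 +
        (4 * Real.pi * ρ ‖x‖ - 3 * (radialMass ρ ‖x‖ / ‖x‖ ^ 3)) / ‖x‖ ^ 2 * inner ℝ e x ^ 2 := by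
  have hr : ‖x‖ ≠ 0 := norm_ne_zero_iff.2 hx
  set F := fun y : Space => radialPotential ρ c ‖y‖
  have hd : DifferentiableAt ℝ (fderiv ℝ F) x :=
    ((contDiff_radialPotential_norm hρ hε h0 c).fderiv_right
      (m := 1) (by norm_num)).differentiable one_ne_zero x
  have h1 : fderiv ℝ (fderiv ℝ F) x e e = fderiv ℝ (fun y => fderiv ℝ F y e) x e := by
    rw [fderiv_clm_apply hd (differentiableAt_const e)]
    simp
  rw [h1, funext fun y => fderiv_radialPotential_apply hρ hε h0 c y e]
  have hder : HasDerivAt (fun r => radialMass ρ r / r ^ 3)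
      ((4 * Real.pi * (‖x‖ ^ 2 * ρ ‖x‖) * ‖x‖ ^ 3 - radialMass ρ ‖x‖ * (3 * ‖x‖ ^ 2)) /
        (‖x‖ ^ 3) ^ 2) ‖x‖ := by
    refine HasDerivAt.congr_deriv
      ((hasDerivAt_radialMass hρ ‖x‖).div (hasDerivAt_pow 3 ‖x‖) (pow_ne_zero 3 hr)) ?_
    norm_num
  have hg := hasGradientAt_iff_hasFDerivAt.1 (hasGradientAt_comp_norm hx hder)
  have hi : HasFDerivAt (fun y : Space => inner ℝ y e) (innerSL ℝ e) x := by
    simpa [real_inner_comm] using (innerSL ℝ e).hasFDerivAt (x := x)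
  rw [HasFDerivAt.fderiv (f := fun y : Space => radialMass ρ ‖y‖ / ‖y‖ ^ 3 * inner ℝ y e)
    (hg.mul hi)]
  simp [real_inner_comm e x]
  field_simp

theorem laplacian_radialPotential (hρ : Continuous ρ) (hε : 0 < ε)
    (h0 : ∀ s, |s| < ε → ρ s = 0) (c : ℝ) (x : Space) :
    Laplacian.laplacian (fun y : Space => radialPotential ρ c ‖y‖) x =
      4 * Real.pi * ρ ‖x‖ := by
  rcases eq_or_ne x 0 with rfl | hx
  · have : (fun y : Space => radialPotential ρ c ‖y‖) =ᶠ[𝓝 0] fun _ => c := by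
      filter_upwards [norm_lt_mem_nhds_zero hε] with y hy
      exact radialPotential_eq h0 (by rwa [abs_norm]) c
    rw [(InnerProductSpace.laplacian_congr_nhds this).eq_of_nhds, h0 ‖(0 : Space)‖ (by simpa)]
    simp [InnerProductSpace.laplacian_const]
  · have hr : ‖x‖ ≠ 0 := norm_ne_zero_iff.2 hx
    let b := EuclideanSpace.basisFun (Fin 3) ℝ
    rw [InnerProductSpace.laplacian_eq_iteratedFDeriv_orthonormalBasis _ b]
    simp only [iteratedFDeriv_two_apply, Matrix.cons_val_zero, Matrix.cons_val_one]
    simp only [second_fderiv_radialPotential hρ hε h0 c hx, b.norm_eq_one]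
    rw [Finset.sum_add_distrib, ← Finset.mul_sum, ← Finset.mul_sum, b.sum_sq_inner_right]
    simp
    field_simp
    ring

end Radial

/-! ### Regularity of the shell density and of its potential -/

/-- Starts the bootstrap: a primitive of an integrable function is continuous, which needs no
regularity of the density. Continuity of `U` off `0` gives a continuous density, and that gives `U ∈
C²`. -/
theorem FiniteEnergy.continuousAt_potential {L0 : ℝ} {f : Phase → ℝ} (hf : FiniteEnergy L0 f)
    {x : Space} (hx : x ≠ 0) : ContinuousAt (potential f) x := by
  have hr : 0 < ‖x‖ := norm_pos_iff.2 hx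
  set δ := ‖x‖ / 2
  have hδ : 0 < δ := by positivity
  set q := fun s => ballMass f s / s ^ 2
  have hq : IntegrableOn q (Ioi δ) := hf.integrableOn_ballMass_div_sq hδ
  have hle : δ ≤ 2 * ‖x‖ := by
    simp only [δ]
    linarith
  have hqi : IntervalIntegrable q volume δ (2 * ‖x‖) :=
    (intervalIntegrable_iff_integrableOn_Ioc_of_le hle).2 (hq.mono_set Ioc_subset_Ioi_self)
  have hc := intervalIntegral.continuousOn_primitive_interval' hqi left_mem_uIcc
  rw [uIcc_of_le hle] at hc
  have hlt : δ < ‖x‖ := by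
    simp only [δ]
    linarith
  have hca : ContinuousAt (fun r => ∫ s in δ..r, q s) ‖x‖ :=
    hc.continuousAt (Icc_mem_nhds hlt (by linarith))
  have hcx : ContinuousAt (fun y : Space => (∫ s in δ..‖y‖, q s) - ∫ s in Ioi δ, q s) x :=
    (ContinuousAt.comp (f := fun y : Space => ‖y‖) hca continuous_norm.continuousAt).sub
      continuousAt_const
  refine hcx.congr ?_
  filter_upwards [(isOpen_lt continuous_const continuous_norm).mem_nhds hlt] with y hy
  have hy' : δ < ‖y‖ := hy
  have hsplit := intervalIntegral.integral_interval_add_Ioi hq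
    (hf.integrableOn_ballMass_div_sq (hδ.trans hy'))
  rw [potential]
  linarith

theorem RadialWell.shell_eq_zero_of_norm_lt (hU : RadialWell A U) (hk : 0 < k) (hl : 0 < l)
    (hL0 : 0 < L0) (hD : 0 < A + Mc) (hE0 : E0 < 0) {z : Phase}
    (hz : ‖z.1‖ < L0 / (2 * (A + Mc))) : shell k l L0 Mc E0 U z = 0 := by
  by_contra h
  obtain ⟨hL, hE⟩ := lt_of_shell_ne_zero hk hl h
  exact absurd (hU.support_bounds hD hL0 hE0.le hL hE).1 (not_le.2 hz)

theorem RadialWell.density_shell_eq_zero (hU : RadialWell A U) (hk : 0 < k) (hl : 0 < l)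
    (hL0 : 0 < L0) (hD : 0 < A + Mc) (hE0 : E0 < 0) {x : Space}
    (hx : ‖x‖ < L0 / (2 * (A + Mc))) : density (shell k l L0 Mc E0 U) x = 0 := by
  rw [density, integral_congr_ae (ae_of_all _ fun v =>
    hU.shell_eq_zero_of_norm_lt hk hl hL0 hD hE0 (z := (x, v)) hx), integral_zero]

theorem RadialWell.density_shell_eq_zero_of_lt_norm (hU : RadialWell A U) (hk : 0 < k)
    (hl : 0 < l) (hL0 : 0 < L0) (hD : 0 < A + Mc) (hE0 : E0 < 0) {x : Space}
    (hx : (A + Mc) / -E0 < ‖x‖) : density (shell k l L0 Mc E0 U) x = 0 := by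
  rw [density, integral_congr_ae (g := fun _ => 0) (ae_of_all _ fun v => ?_), integral_zero]
  by_contra h
  obtain ⟨hL, hE⟩ := lt_of_shell_ne_zero hk hl h
  have := (hU.support_bounds hD hL0 hE0.le hL hE).2.1
  rw [div_lt_iff₀ (by linarith)] at hx
  simp only at this
  linarith

theorem RadialWell.isShell_shell (hU : RadialWell A U) (hk : 0 < k)
    (hl : 0 < l) (hL0 : 0 < L0) (hD : 0 < A + Mc) (hE0 : E0 < 0) :
    IsShell (shell k l L0 Mc E0 U) := by
  -- The maximum only serves to make `R1 < R2` immediate.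
  refine ⟨L0 / (2 * (A + Mc)), max (L0 / (2 * (A + Mc)) + 1) ((A + Mc) / -E0), by positivity,
    lt_of_lt_of_le (lt_add_one _) (le_max_left _ _), fun x hx => ⟨?_, ?_⟩⟩
  · by_contra! h
    exact hx (hU.density_shell_eq_zero hk hl hL0 hD hE0 h)
  · refine le_max_of_le_right ?_
    by_contra! h
    exact hx (hU.density_shell_eq_zero_of_lt_norm hk hl hL0 hD hE0 h)

theorem RadialWell.shell_le_velocity_bound (hU : RadialWell A U) (hk : 0 < k) (hl : 0 < l)
    (hL0 : 0 < L0) (hD : 0 < A + Mc) (hE0 : E0 < 0) :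
    ∃ V C : ℝ, ∀ x v : Space, ‖shell k l L0 Mc E0 U (x, v)‖ ≤
      (Metric.closedBall (0 : Space) V).indicator (fun _ => C) v := by
  obtain ⟨R, V, C, hC, h⟩ := hU.exists_shell_bound hk hl hL0 hD (neg_pos.2 hE0)
  refine ⟨V, C, fun x v => ?_⟩
  rw [Real.norm_of_nonneg (shell_nonneg hk _)]
  refine (h E0 (by simp) (x, v)).trans ?_
  simp only [indicator]
  split_ifs with h1 h2
  · exact le_rfl
  · exact absurd h1.2 h2
  · exact hC
  · exact le_rfl

theorem integrable_closedBall_indicator (V C : ℝ) :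
    Integrable ((Metric.closedBall (0 : Space) V).indicator fun _ => C) := by
  rw [integrable_indicator_iff Metric.isClosed_closedBall.measurableSet]
  exact integrableOn_const (isCompact_closedBall _ _).measure_lt_top.ne

theorem RadialWell.measurable_shell_velocity (hU : RadialWell A U) (x : Space) :
    Measurable fun v => shell k l L0 Mc E0 U (x, v) :=
  (measurable_shell hU).comp measurable_prodMk_left

theorem RadialWell.integrable_shell_velocity (hU : RadialWell A U) (hk : 0 < k) (hl : 0 < l)
    (hL0 : 0 < L0) (hD : 0 < A + Mc) (hE0 : E0 < 0) (x : Space) :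
    Integrable fun v => shell k l L0 Mc E0 U (x, v) := by
  obtain ⟨V, C, h⟩ := hU.shell_le_velocity_bound hk hl hL0 hD hE0
  exact (integrable_closedBall_indicator V C).mono'
    (hU.measurable_shell_velocity x).aestronglyMeasurable (ae_of_all _ fun v => h x v)

theorem RadialWell.continuous_density_shell (hU : RadialWell A U) (hk : 0 < k) (hl : 0 < l)
    (hL0 : 0 < L0) (hD : 0 < A + Mc) (hE0 : E0 < 0)
    (hUc : ∀ x, x ≠ 0 → ContinuousAt U x) : Continuous (density (shell k l L0 Mc E0 U)) := by
  obtain ⟨V, C, h⟩ := hU.shell_le_velocity_bound hk hl hL0 hD hE0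
  unfold density
  refine continuous_of_dominated (fun x => (hU.measurable_shell_velocity x).aestronglyMeasurable)
    (fun x => ae_of_all _ fun v => h x v) (integrable_closedBall_indicator V C)
    (ae_of_all _ fun v => ?_)
  rw [continuous_iff_continuousAt]
  intro x
  rcases eq_or_ne x 0 with rfl | hx
  -- At the origin the integrand is locally zero, so the singularity of `Mc / |x|` does not matter.
  · refine ContinuousAt.congr (f := fun _ => 0) continuousAt_const ?_
    filter_upwards [norm_lt_mem_nhds_zero (by positivity : 0 < L0 / (2 * (A + Mc)))] with y hy
    exact (hU.shell_eq_zero_of_norm_lt hk hl hL0 hD hE0 (z := (y, v)) hy).symm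
  · have hr : ‖x‖ ≠ 0 := norm_ne_zero_iff.2 hx
    have hUx := hUc x hx
    have hE : ContinuousAt (fun y => max (E0 - particleEnergy Mc U (y, v)) 0) x := by
      unfold particleEnergy
      fun_prop (disch := assumption)
    have hL : ContinuousAt (fun y => max (angMomSq (y, v) - L0) 0) x := by
      unfold angMomSq
      fun_prop
    exact ((hE.rpow_const (Or.inr hk.le)).const_mul _).mul (hL.rpow_const (Or.inr hl.le))

/-- The reflection exchanging `x` and `y` preserves the shell, and preserves Lebesgue measure in
`v`. -/
theorem RadialWell.density_shell_radial (hU : RadialWell A U) {x y : Space} (hxy : ‖x‖ = ‖y‖) :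
    density (shell k l L0 Mc E0 U) x = density (shell k l L0 Mc E0 U) y := by
  let T : Space ≃ₗᵢ[ℝ] Space := (ℝ ∙ (x - y))ᗮ.reflection
  have hT : T x = y := Submodule.reflection_sub hxy
  have hT' := T.measurePreserving.integral_comp T.toHomeomorph.measurableEmbedding
    fun v => shell k l L0 Mc E0 U (T x, v)
  simp only [hU.shell_map] at hT'
  rw [density, density, hT', hT]

/-- The radial profile of the density of a shell. -/
noncomputable def shellProfile (k l L0 Mc E0 : ℝ) (U : Space → ℝ) (r : ℝ) : ℝ :=
  density (shell k l L0 Mc E0 U) (r • EuclideanSpace.single 0 1)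

theorem norm_smul_single (r : ℝ) : ‖r • (EuclideanSpace.single 0 1 : Space)‖ = |r| := by
  rw [norm_smul, PiLp.norm_single, norm_one, mul_one, Real.norm_eq_abs]

theorem RadialWell.density_shell_eq_profile (hU : RadialWell A U) (x : Space) :
    density (shell k l L0 Mc E0 U) x = shellProfile k l L0 Mc E0 U ‖x‖ :=
  hU.density_shell_radial (by rw [norm_smul_single, abs_norm])

theorem density_ae_eq {f g : Phase → ℝ} (h : f =ᵐ[volume] g) :
    density f =ᵐ[volume] density g := by
  rw [Measure.volume_eq_prod] at h
  filter_upwards [Measure.ae_ae_of_ae_prod h] with x hx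
  exact integral_congr_ae hx

theorem ballMass_eq_radialMass {f g : Phase → ℝ} {ρ : ℝ → ℝ} (h : f =ᵐ[volume] g)
    (hg : ∀ x, density g x = ρ ‖x‖) {r : ℝ} (hr : 0 ≤ r) :
    ballMass f r = radialMass ρ r := by
  have h1 : ballMass f r = ∫ x in Metric.closedBall (0 : Space) r, ρ ‖x‖ := by
    refine integral_congr_ae (ae_restrict_of_ae ?_)
    filter_upwards [density_ae_eq h] with x hx
    rw [hx, hg]
  have h2 : (Metric.closedBall (0 : Space) r).indicator (fun x : Space => ρ ‖x‖) =
      fun x => (Iic r).indicator ρ ‖x‖ := by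
    ext x
    simp [indicator]
  have h3 : (fun s : ℝ => s ^ 2 * (Iic r).indicator ρ s) =
      (Iic r).indicator fun s => s ^ 2 * ρ s := by
    ext s
    simp [indicator]
  rw [h1, ← integral_indicator Metric.isClosed_closedBall.measurableSet, h2, integral_radial, h3,
    setIntegral_indicator measurableSet_Iic, Ioi_inter_Iic, radialMass,
    intervalIntegral.integral_of_le hr, integral_const_mul]

/-- Splits the integral over `(0, ∞)` at `|x|`. It converges at `0` because the mass vanishes there;
the additive constant is the value at the centre. -/
theorem FiniteEnergy.potential_eq_radialPotential {L0 ε : ℝ} {f : Phase → ℝ} {ρ : ℝ → ℝ}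
    (hf : FiniteEnergy L0 f) (hρ : Continuous ρ) (hε : 0 < ε) (h0 : ∀ s, |s| < ε → ρ s = 0)
    (hm : ∀ r, 0 ≤ r → ballMass f r = radialMass ρ r) :
    potential f = fun x => radialPotential ρ (-∫ s in Ioi 0, radialMass ρ s / s ^ 2) ‖x‖ := by
  have hc := (contDiff_radialMass_div_pow hρ hε h0 2).continuous
  have hcongr : ∀ r, 0 ≤ r → EqOn (fun s => ballMass f s / s ^ 2)
      (fun s => radialMass ρ s / s ^ 2) (Ioi r) := fun r hr s hs => by
    simp only [hm s (hr.trans (le_of_lt hs))]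
  have h1 : IntegrableOn (fun s => radialMass ρ s / s ^ 2) (Ioi 1) :=
    (hf.integrableOn_ballMass_div_sq one_pos).congr_fun (hcongr 1 zero_le_one) measurableSet_Ioi
  have hi : IntegrableOn (fun s => radialMass ρ s / s ^ 2) (Ioi 0) := by
    rw [← Ioc_union_Ioi_eq_Ioi (zero_le_one' ℝ)]
    exact (hc.integrableOn_Icc.mono_set Ioc_subset_Icc_self).union h1
  ext x
  have hsplit := intervalIntegral.integral_interval_add_Ioi hi
    (hi.mono_set (Ioi_subset_Ioi (norm_nonneg x)))
  rw [potential, setIntegral_congr_fun measurableSet_Ioi (hcongr _ (norm_nonneg x)),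
    radialPotential]
  linarith

/-! ### Characteristics and the Vlasov equation -/

section Dynamics

variable {a b : ℝ} {β : Space → ℝ} {X V : ℝ → Space}

theorem particleEnergy_eq (z : Phase) :
    particleEnergy Mc U z = (1 / 2) * ‖z.2‖ ^ 2 + effPotential Mc U z.1 := by
  rw [particleEnergy, effPotential]
  ring

theorem eq_of_hasDerivAt_zero {φ : ℝ → ℝ} (hφ : ∀ s ∈ Ioo a b, HasDerivAt φ 0 s) {s t : ℝ}
    (hs : s ∈ Ioo a b) (ht : t ∈ Ioo a b) : φ s = φ t :=
  isOpen_Ioo.is_const_of_deriv_eq_zero isPreconnected_Ioo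
    (fun r hr => (hφ r hr).differentiableAt.differentiableWithinAt)
    (fun r hr => (hφ r hr).deriv) hs ht

theorem IsCharacteristic.particleEnergy_eq (hc : IsCharacteristic Mc U a b X V)
    (hβ : ∀ x, x ≠ 0 → HasGradientAt (effPotential Mc U) (β x • x) x) {s t : ℝ}
    (hs : s ∈ Ioo a b) (ht : t ∈ Ioo a b) :
    particleEnergy Mc U (X s, V s) = particleEnergy Mc U (X t, V t) := by
  refine eq_of_hasDerivAt_zero (φ := fun r => particleEnergy Mc U (X r, V r)) (fun r hr => ?_) hs ht
  obtain ⟨hX0, hX, hV⟩ := hc r hr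
  have hg := hβ _ hX0
  rw [hg.gradient] at hV
  have h1 := hV.norm_sq.const_mul (1 / 2 : ℝ)
  have h2 := (hasGradientAt_iff_hasFDerivAt.1 hg).comp_hasDerivAt r hX
  have h := h1.add h2
  simp only [VPShell.particleEnergy_eq]
  refine HasDerivAt.congr_deriv h ?_
  simp [inner_neg_right, inner_smul_right, real_inner_comm]

/-- The force is central, `V' = -β X`, and on inserting this the derivative of `|X|²|V|² - (X · V)²`
cancels identically. -/
theorem IsCharacteristic.angMomSq_eq (hc : IsCharacteristic Mc U a b X V)
    (hβ : ∀ x, x ≠ 0 → HasGradientAt (effPotential Mc U) (β x • x) x) {s t : ℝ}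
    (hs : s ∈ Ioo a b) (ht : t ∈ Ioo a b) :
    angMomSq (X s, V s) = angMomSq (X t, V t) := by
  refine eq_of_hasDerivAt_zero (φ := fun r => angMomSq (X r, V r)) (fun r hr => ?_) hs ht
  obtain ⟨hX0, hX, hV⟩ := hc r hr
  rw [(hβ _ hX0).gradient] at hV
  have h := (hX.norm_sq.mul hV.norm_sq).sub ((hX.inner ℝ hV).pow 2)
  refine HasDerivAt.congr_deriv h ?_
  simp only [inner_neg_right, inner_smul_right, real_inner_self_eq_norm_sq,
    real_inner_comm (X r) (V r)]
  push_cast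
  ring

theorem IsCharacteristic.shell_eq (hc : IsCharacteristic Mc U a b X V)
    (hβ : ∀ x, x ≠ 0 → HasGradientAt (effPotential Mc U) (β x • x) x) {s t : ℝ}
    (hs : s ∈ Ioo a b) (ht : t ∈ Ioo a b) :
    shell k l L0 Mc E0 U (X s, V s) = shell k l L0 Mc E0 U (X t, V t) := by
  rw [shell, shell, hc.particleEnergy_eq hβ hs ht, hc.angMomSq_eq hβ hs ht]

/-- Through every point off the centre there passes a characteristic. -/
theorem exists_isCharacteristic (hβ : ∀ x, x ≠ 0 → HasGradientAt (effPotential Mc U) (β x • x) x)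
    (hβc : ∀ x, x ≠ 0 → ContDiffAt ℝ 1 β x) {x : Space} (hx : x ≠ 0) (v : Space) :
    ∃ δ > 0, ∃ X V : ℝ → Space, X 0 = x ∧ V 0 = v ∧ IsCharacteristic Mc U (-δ) δ X V := by
  have hG : ContDiffAt ℝ 1 (fun z : Phase => (z.2, -(β z.1 • z.1))) (x, v) := by
    have h1 : ContDiffAt ℝ 1 (fun z : Phase => β z.1) (x, v) :=
      (hβc x hx).comp (x, v) contDiffAt_fst
    exact contDiffAt_snd.prodMk (h1.smul contDiffAt_fst).neg
  obtain ⟨α, hα0, ε, hε, hα⟩ :=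
    hG.exists_forall_mem_closedBall_exists_eq_forall_mem_Ioo_hasDerivAt₀ 0
  have hc : ContinuousAt (fun t => (α t).1) 0 :=
    continuous_fst.continuousAt.comp (hα 0 (by simp [hε])).continuousAt
  -- The local solution may run into the centre, so the time interval is shortened until it does
  -- not.
  have hne : ∀ᶠ t in 𝓝 0, (α t).1 ≠ 0 := hc.eventually_ne (by simpa [hα0] using hx)
  obtain ⟨η, hη, hηne⟩ := Metric.eventually_nhds_iff.1 hne
  refine ⟨min ε η, lt_min hε hη, fun t => (α t).1, fun t => (α t).2, by simp [hα0],
    by simp [hα0], fun s hs => ?_⟩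
  have hsη : (α s).1 ≠ 0 := by
    refine hηne ?_
    rw [Real.dist_eq, sub_zero, abs_lt]
    exact ⟨by linarith [hs.1, min_le_right ε η], by linarith [hs.2, min_le_right ε η]⟩
  have hd := hα s ⟨by linarith [hs.1, min_le_left ε η], by linarith [hs.2, min_le_left ε η]⟩
  refine ⟨hsη, hd.fst, ?_⟩
  rw [(hβ _ hsη).gradient]
  exact hd.snd

/-- Differentiate `f` along the characteristic through `(x, v)` at time `0`: the chain rule needs
differentiability only at that point. -/
theorem vlasov_of_const_along {f : Phase → ℝ}
    (hf : ∀ (a b : ℝ) (X V : ℝ → Space), IsCharacteristic Mc U a b X V →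
      ∀ s ∈ Ioo a b, ∀ t ∈ Ioo a b, f (X s, V s) = f (X t, V t))
    (hβ : ∀ x, x ≠ 0 → HasGradientAt (effPotential Mc U) (β x • x) x)
    (hβc : ∀ x, x ≠ 0 → ContDiffAt ℝ 1 β x) {x v : Space} (hx : x ≠ 0)
    (hd : DifferentiableAt ℝ f (x, v)) :
    inner ℝ v (gradient (fun y : Space => f (y, v)) x)
      - inner ℝ (gradient (effPotential Mc U) x) (gradient (fun w : Space => f (x, w)) v) = 0 := by
  obtain ⟨δ, hδ, X, V, hX0, hV0, hc⟩ := exists_isCharacteristic hβ hβc hx v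
  obtain ⟨-, hX, hV⟩ := hc 0 (by simp [hδ])
  rw [hX0] at hV
  rw [hV0] at hX
  have hd' : HasFDerivAt f (fderiv ℝ f (x, v)) (X 0, V 0) := by
    rw [hX0, hV0]
    exact hd.hasFDerivAt
  have h1 : HasDerivAt (fun t => f (X t, V t))
      (fderiv ℝ f (x, v) (v, -gradient (effPotential Mc U) x)) 0 :=
    HasFDerivAt.comp_hasDerivAt (f := fun t => (X t, V t)) 0 hd' (hX.prodMk hV)
  have h2 : HasDerivAt (fun t => f (X t, V t)) 0 0 := by
    refine (hasDerivAt_const (0 : ℝ) (f (X 0, V 0))).congr_of_eventuallyEq ?_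
    filter_upwards [Ioo_mem_nhds (neg_lt_zero.2 hδ) hδ] with t ht
    exact hf _ _ X V hc t ht 0 (by simp [hδ])
  have h3 := h1.unique h2
  have hgx : ∀ w, inner ℝ w (gradient (fun y : Space => f (y, v)) x) =
      fderiv ℝ f (x, v) (w, 0) := by
    intro w
    have hp : HasFDerivAt (fun y : Space => (y, v)) (ContinuousLinearMap.inl ℝ Space Space) x :=
      hasFDerivAt_prodMk_left x v
    have hcomp : HasFDerivAt (fun y : Space => f (y, v))
      ((fderiv ℝ f (x, v)).comp (ContinuousLinearMap.inl ℝ Space Space)) x :=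
      HasFDerivAt.comp (g := f) x hd.hasFDerivAt hp
    rw [gradient, hcomp.fderiv, real_inner_comm, InnerProductSpace.toDual_symm_apply]
    simp
  have hgv : ∀ w, inner ℝ w (gradient (fun y : Space => f (x, y)) v) =
      fderiv ℝ f (x, v) (0, w) := by
    intro w
    have hp : HasFDerivAt (fun y : Space => (x, y)) (ContinuousLinearMap.inr ℝ Space Space) v :=
      hasFDerivAt_prodMk_right x v
    have hcomp : HasFDerivAt (fun y : Space => f (x, y))
      ((fderiv ℝ f (x, v)).comp (ContinuousLinearMap.inr ℝ Space Space)) v :=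
      HasFDerivAt.comp (g := f) v hd.hasFDerivAt hp
    rw [gradient, hcomp.fderiv, real_inner_comm, InnerProductSpace.toDual_symm_apply]
    simp
  rw [hgx, hgv, ← map_sub, Prod.mk_sub_mk, sub_zero, zero_sub]
  exact h3

end Dynamics

/-! ### The steady state and the conclusion -/

theorem RadialWell.tendsto_zero {A : ℝ} {U : Space → ℝ} (hU : RadialWell A U) :
    Tendsto U (cocompact Space) (𝓝 0) := by
  have hn : Tendsto (fun x : Space => ‖x‖) (cocompact Space) atTop := tendsto_norm_cocompact_atTop
  have hlow : Tendsto (fun x : Space => -(A / ‖x‖)) (cocompact Space) (𝓝 0) := by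
    simpa using (hn.const_div_atTop A).neg
  refine tendsto_of_tendsto_of_tendsto_of_le_of_le' hlow tendsto_const_nhds ?_
    (Eventually.of_forall hU.nonpos)
  filter_upwards [hn.eventually_gt_atTop 0] with x hx
  exact hU.lower x (norm_pos_iff.1 hx)

/-- A finite-energy density that is almost everywhere a shell in its own potential is a steady
state. -/
theorem FiniteEnergy.isSteadyState {f : Phase → ℝ} (hf : FiniteEnergy L0 f) (hk : 0 < k)
    (hl : 0 < l) (hL0 : 0 < L0) (hMc : 0 < Mc) (hE0 : E0 < 0)
    (hfs : f =ᵐ[volume] shell k l L0 Mc E0 (potential f)) :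
    IsSteadyState Mc (shell k l L0 Mc E0 (potential f)) (potential f) := by
  have hU := hf.radialWell
  have hA : 0 ≤ ∫ z, f z := integral_nonneg_of_ae hf.nonneg
  have hD : 0 < (∫ z, f z) + Mc := by positivity
  set ε := L0 / (2 * ((∫ z, f z) + Mc))
  have hε : 0 < ε := by positivity
  set ρ := shellProfile k l L0 Mc E0 (potential f)
  have hρ : Continuous ρ :=
    (hU.continuous_density_shell hk hl hL0 hD hE0 fun x hx => hf.continuousAt_potential hx).comp
      (by fun_prop)
  have h0 : ∀ s, |s| < ε → ρ s = 0 := fun s hs =>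
    hU.density_shell_eq_zero hk hl hL0 hD hE0 (by rwa [norm_smul_single])
  have hdens : ∀ x, density (shell k l L0 Mc E0 (potential f)) x = ρ ‖x‖ :=
    hU.density_shell_eq_profile
  obtain ⟨c, hpot⟩ : ∃ c, potential f = fun x => radialPotential ρ c ‖x‖ :=
    ⟨_, hf.potential_eq_radialPotential hρ hε h0 fun r hr => ballMass_eq_radialMass hfs hdens hr⟩
  let β : Space → ℝ := fun x => radialMass ρ ‖x‖ / ‖x‖ ^ 3 + Mc / ‖x‖ ^ 3
  have hβ : ∀ x, x ≠ 0 → HasGradientAt (effPotential Mc (potential f)) (β x • x) x := by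
    intro x hx
    have hr : ‖x‖ ≠ 0 := norm_ne_zero_iff.2 hx
    have h1 := hasGradientAt_iff_hasFDerivAt.1 (hasGradientAt_radialPotential hρ hε h0 c x)
    have h2 := hasGradientAt_iff_hasFDerivAt.1
      (hasGradientAt_comp_norm hx ((hasDerivAt_inv hr).const_mul Mc))
    rw [hasGradientAt_iff_hasFDerivAt]
    have h3 : effPotential Mc (potential f) =
        fun y : Space => radialPotential ρ c ‖y‖ - Mc * ‖y‖⁻¹ := by
      ext y
      rw [effPotential, hpot, div_eq_mul_inv]
    rw [h3]
    refine HasFDerivAt.congr_fderiv (h1.sub h2) ?_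
    rw [← map_sub, ← sub_smul]
    congr 2
    simp only [β]
    field_simp
    ring
  have hβc : ∀ x, x ≠ 0 → ContDiffAt ℝ 1 β x := by
    intro x hx
    have hr : ‖x‖ ≠ 0 := norm_ne_zero_iff.2 hx
    have hn : ContDiffAt ℝ 1 (fun y : Space => ‖y‖) x := contDiffAt_norm ℝ hx
    exact ((contDiff_radialMass_div_pow hρ hε h0 3).contDiffAt.comp x hn).add
      (contDiffAt_const.div (hn.pow 3) (pow_ne_zero 3 hr))
  have hconst : ∀ (a b : ℝ) (X V : ℝ → Space), IsCharacteristic Mc (potential f) a b X V →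
      ∀ s ∈ Ioo a b, ∀ t ∈ Ioo a b, shell k l L0 Mc E0 (potential f) (X s, V s) =
        shell k l L0 Mc E0 (potential f) (X t, V t) :=
    fun a b X V hc s hs t ht => hc.shell_eq hβ hs ht
  refine ⟨fun z => shell_nonneg hk z, hconst,
    fun x v hx hd => vlasov_of_const_along hconst hβ hβc hx hd, ?_,
    hU.integrable_shell_velocity hk hl hL0 hD hE0, fun x => ?_, hU.tendsto_zero⟩
  · rw [hpot]
    exact contDiff_radialPotential_norm hρ hε h0 c
  · rw [hdens, hpot]
    exact laplacian_radialPotential hρ hε h0 c x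

end VPShell

theorem theorem5p2 (k l L0 Mc M : ℝ) (hk : 0 < k) (hkl : k ≤ l) (hL0 : 0 < L0)
    (hMc : 0 < Mc) (hM : 0 < M) (f0 : VPShell.Phase → ℝ)
    (hf0 : f0 ∈ VPShell.admissible k l L0 M)
    (hmin : IsMinOn (VPShell.energyCasimir k l L0 Mc) (VPShell.admissible k l L0 M) f0) :
    ∃ E0 : ℝ, E0 < 0 ∧
      f0 =ᵐ[volume] VPShell.shell k l L0 Mc E0 (VPShell.potential f0) ∧
      ContDiff ℝ 2 (VPShell.potential f0) ∧
      VPShell.IsSteadyState Mc (VPShell.shell k l L0 Mc E0 (VPShell.potential f0))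
        (VPShell.potential f0) ∧
      VPShell.IsShell (VPShell.shell k l L0 Mc E0 (VPShell.potential f0)) := by
  have hl : 0 < l := hk.trans_le hkl
  have hF := VPShell.admissible.finiteEnergy hf0
  have hU := hF.radialWell
  rw [hf0.2.2.2.1] at hU
  have hD : 0 < M + Mc := by positivity
  -- `E0` is fixed by the mass alone, before anything is known about the form of `f0`; the well
  -- constant is `A = M`.
  obtain ⟨E0, hE0, hmass⟩ := hU.exists_mass_eq hk hkl hL0 hMc hM.le hM
  have hg := hU.shell_mem_admissible hk hl hL0 hD hE0
  rw [hmass] at hg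
  have hae := VPShell.minimizer_ae_eq_shell hk hl hL0 hf0 hmin hg
  have hS := hF.isSteadyState hk hl hL0 hMc hE0 hae
  exact ⟨E0, hE0, hae, hS.potential_contDiff, hS, hU.isShell_shell hk hl hL0 hD hE0⟩
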